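/- **Definitions.** A strict partition is a finite strictly decreasing sequence $\lambda=(\lambda_1>\lambda_2>\dots>\lambda_r>0)$ of positive integers; set $\ell(\lambda)=r$ and $\lambda_i=0$ for $i>r$. Its shifted diagram is $\mathsf{SD}_\lambda=\{(i,j)\in\mathbb Z\times\mathbb Z: 0<i\le j<i+\lambda_i\}$. Write $\mu\subseteq\lambda$ if $\mu_i\le\lambda_i$ for all $i$, and then put $\mathsf{SD}_{\lambda/\mu}=\mathsf{SD}_\lambda\setminus\mathsf{SD}_\mu$, $|\lambda/\mu|=|\mathsf{SD}_{\lambda/\mu}|$, $$\mathsf{cols}(\lambda/\mu)=|\{j:(i,j)\in\mathsf{SD}_{\lambda/\mu}\text{ for some }i\}|,\qquad \mathsf{overlap}(\lambda/\mu)=|\{(i,j)\in\mathsf{SD}_{\lambda/\mu}:(i-1,j)\in\mathsf{SD}_{\lambda/\mu}\}|.$$ The set $\mathsf{SD}_{\lambda/\mu}$ is a vertical strip if it contains at most one position in each row. Write $i'=i-\tfrac12$, so that the positive half-integers are $1'<1<2'<2<\cdots$. For $\mu\subseteq\lambda$, let $\mathrm{SetShYT}_Q(\lambda/\mu)$ be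 the set of fillings $T$ of $\mathsf{SD}_{\lambda/\mu}$ by nonempty finite sets $T_{ij}$ of positive half-integers such that rows and columns are weakly increasing (where a sequence of sets $S_1,S_2,\dots$ is weakly increasing if $\max S_k\le\min S_{k+1}$ for all $k$), no unprimed number occurs in two boxes of one column, and no primed number occurs in two boxes of one row. Let $\mathrm{SetShYT}_P(\lambda/\mu)$ be the subset of those $T$ with no primed number in any diagonal box $(j,j)$. Put $|T|=\sum_{(i,j)}|T_{ij}|$ and $x^T=\prod_{i\ge1}x_i^{m_i}$, where $m_i$ is the number of times that $i$ or $i'$ occurs in $T$. Define in $\mathbb Z[\beta][[x_1,x_2,\dots]]$ $$GP_{\lambda/\mu}=\sum_{T\in \mathrm{SetShYT}_P(\lambda/\mu)}\beta^{|T|-|\lambda/\mu|}x^T,\qquad GQ_{\lambda/\mu}=\sum_{T\in \mathrm{SetShYT}_Q(\lambda/\mu)}\beta^{|T|-|\lambda/\mu|}x^T.$$ Let $\mathsf{Rem}(\mu)$ be the set of $(i,j)\in\mathsf{SD}_\mu$ such that $\mathsf{SD}_\mu\setminus\{(i,j)\}$ is the shifted diagram of a strict partition, and for $\mu\subseteq\lambda$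 define $$GP_{\lambda/\!/\mu}=\sum_{\rho}\beta^{|\mu/\rho|}GP_{\lambda/\rho},\qquad GQ_{\lambda/\!/\mu}=\sum_{\rho}\beta^{|\mu/\rho|}GQ_{\lambda/\rho},$$ where both sums are over the strict partitions $\rho\subseteq\mu$ with $\mathsf{SD}_{\mu/\rho}\subseteq\mathsf{Rem}(\mu)$. **Theorem.** Let $\nu\subseteq\mu$ be strict partitions. Then, in $\mathbb Q[\beta][[x_1,x_2,\dots]]$, $$GQ_{\mu/\!/\nu}=\sum_{(\kappa,\lambda)}2^{\ell(\mu)-\ell(\nu)+\mathsf{overlap}(\nu/\kappa)}\,(-1)^{\mathsf{cols}(\lambda/\mu)}\,(-\beta/2)^{|\nu/\kappa|+|\lambda/\mu|}\;GP_{\lambda/\!/\kappa},$$ where the (finite) sum is over all pairs $(\kappa,\lambda)$ of strict partitions with $\kappa\subseteq\nu\subseteq\mu\subseteq\lambda$ and $\ell(\kappa)=\ell(\nu)\le\ell(\mu)=\ell(\lambda)$ such that $\mathsf{SD}_{\lambda/\mu}$ is a vertical strip. -/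

import Mathlib

/-- A strict partition, recorded as the sequence of its parts followed by zeros: `parts i` is the
`(i+1)`-st part. The two conditions say that the parts strictly decrease as long as they are
positive and that only zeros follow a zero (so only finitely many entries are nonzero). -/
@[ext]
structure StrictPartition where
  parts : ℕ → ℕ
  lt_of_pos : ∀ i, 0 < parts i → parts (i + 1) < parts i
  zero_of_zero : ∀ i, parts i = 0 → parts (i + 1) = 0

namespace StrictPartition

/-- Containment `μ ⊆ lam` of strict partitions: `μ_i ≤ lam_i` for all `i`. -/
instance : LE StrictPartition := ⟨fun μ lam => ∀ i, μ.parts i ≤ lam.parts i⟩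

/-- The number `ℓ(μ)` of positive parts. -/
noncomputable def len (μ : StrictPartition) : ℕ := Set.ncard {i | 0 < μ.parts i}

theorem parts_add_le (μ : StrictPartition) (i : ℕ) (h : 0 < μ.parts i) :
    i + μ.parts i ≤ μ.parts 0 := by
  induction i with
  | zero => simp
  | succ k ih =>
    have hk : 0 < μ.parts k := by
      by_contra h0
      have := μ.zero_of_zero k (by omega)
      omega
    have h1 := μ.lt_of_pos k hk
    have h2 := ih hk
    omega

/-- The shifted diagram, with rows and columns counted from `0`: the box `(i, j)` here is the box
`(i+1, j+1)` in one-based coordinates. See `mem_SD` for the plain description. -/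
def SD (μ : StrictPartition) : Finset (ℕ × ℕ) :=
  (Finset.range (μ.parts 0) ×ˢ Finset.range (μ.parts 0)).filter
    fun p => p.1 ≤ p.2 ∧ p.2 < p.1 + μ.parts p.1

theorem mem_SD (μ : StrictPartition) (i j : ℕ) :
    (i, j) ∈ μ.SD ↔ i ≤ j ∧ j < i + μ.parts i := by
  simp only [SD, Finset.mem_filter, Finset.mem_product, Finset.mem_range]
  constructor
  · exact fun h => h.2
  · intro h
    have := μ.parts_add_le i (by omega)
    omega

theorem SD_injective : Function.Injective SD := by
  intro μ ν h
  ext i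
  have key : ∀ k, k < μ.parts i ↔ k < ν.parts i := by
    intro k
    have h1 := mem_SD μ i (i + k)
    rw [h, mem_SD] at h1
    omega
  have h1 := key (μ.parts i)
  have h2 := key (ν.parts i)
  omega

theorem finite_parts_zero_le (N : ℕ) : {μ : StrictPartition | μ.parts 0 ≤ N}.Finite := by
  refine Set.Finite.of_finite_image (f := SD) ?_ SD_injective.injOn
  refine ((Finset.range N ×ˢ Finset.range N).powerset.finite_toSet).subset ?_
  rintro _ ⟨μ, hμ, rfl⟩
  have hμ' : μ.parts 0 ≤ N := hμ
  simp only [Finset.coe_powerset, Set.mem_preimage, Set.mem_powerset_iff, Finset.coe_subset]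
  intro p hp
  simp only [SD, Finset.mem_filter, Finset.mem_product, Finset.mem_range] at hp ⊢
  omega

theorem finite_le (μ : StrictPartition) : {ν : StrictPartition | ν ≤ μ}.Finite :=
  (finite_parts_zero_le (μ.parts 0)).subset fun _ hν => hν 0

/-- The skew shifted diagram `SD_{lam/μ}` (meant for `μ ≤ lam`). -/
def skewSD (lam μ : StrictPartition) : Finset (ℕ × ℕ) := lam.SD \ μ.SD

/-- `|lam/μ|`. -/
def skewSize (lam μ : StrictPartition) : ℕ := (skewSD lam μ).card

/-- The number of distinct columns that the skew shifted diagram occupies. -/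
def cols (lam μ : StrictPartition) : ℕ := ((skewSD lam μ).image Prod.snd).card

/-- The number of boxes of the skew shifted diagram such that the box directly before it in its
column also lies in the skew shifted diagram. -/
def overlap (lam μ : StrictPartition) : ℕ :=
  ((skewSD lam μ).filter fun p => 1 ≤ p.1 ∧ (p.1 - 1, p.2) ∈ skewSD lam μ).card

/-- The skew shifted diagram has at most one box in each row. -/
def IsVerticalStrip (lam μ : StrictPartition) : Prop :=
  ∀ i j j', (i, j) ∈ skewSD lam μ → (i, j') ∈ skewSD lam μ → j = j'

/-- The removable boxes: those whose removal leaves the shifted diagram of a strict partition. -/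
def Rem (μ : StrictPartition) : Set (ℕ × ℕ) :=
  {p | p ∈ μ.SD ∧ ∃ ρ : StrictPartition, ρ.SD = μ.SD.erase p}

/-- The strict partitions `ν ⊆ μ` such that `SD_{μ/ν}` consists of removable boxes of `μ`. -/
def remSub (μ : StrictPartition) : Set StrictPartition :=
  {ν | ν ≤ μ ∧ (skewSD μ ν : Set (ℕ × ℕ)) ⊆ Rem μ}

theorem remSub_finite (μ : StrictPartition) : (remSub μ).Finite :=
  (finite_le μ).subset fun _ h => h.1

/-- A filling of a finite set of boxes by nonempty finite sets of positive half-integers, extended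
by `∅` to all other boxes. The natural number `a` encodes the half-integer `(a+1)/2`, in the order
`1' < 1 < 2' < 2 < ⋯`: an even `a` is the primed number `(a/2+1)'`, an odd `a` is the unprimed
number `a/2+1`. -/
abbrev Filling := ℕ × ℕ → Finset ℕ

/-- `T` is a semistandard set-valued shifted tableau of shape `lam/μ`. There is none unless
`μ ⊆ lam`. -/
structure IsSetShYTQ (lam μ : StrictPartition) (T : Filling) : Prop where
  le : μ ≤ lam
  nonempty_iff : ∀ p, (T p).Nonempty ↔ p ∈ skewSD lam μ
  row_le : ∀ i j j', j < j' → ∀ a ∈ T (i, j), ∀ b ∈ T (i, j'), a ≤ b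
  col_le : ∀ i i' j, i < i' → ∀ a ∈ T (i, j), ∀ b ∈ T (i', j), a ≤ b
  /-- no unprimed number occurs more than once in a column -/
  col_unprimed : ∀ i i' j, i < i' → ∀ a, Odd a → a ∈ T (i, j) → a ∉ T (i', j)
  /-- no primed number occurs more than once in a row -/
  row_primed : ∀ i j j', j < j' → ∀ a, Even a → a ∈ T (i, j) → a ∉ T (i, j')

/-- In addition, no primed number occurs in a diagonal box. -/
structure IsSetShYTP (lam μ : StrictPartition) (T : Filling) : Prop
    extends IsSetShYTQ lam μ T where
  diag : ∀ i, ∀ a ∈ T (i, i), Odd a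

/-- The number `|T|` of entries of a filling of the boxes in `D`, counted with multiplicity. -/
def entryCount (D : Finset (ℕ × ℕ)) (T : Filling) : ℕ := ∑ p ∈ D, (T p).card

/-- The exponent vector of the weight `x^T` of a filling of the boxes in `D`. The variables
`x_1, x_2, …` are indexed by `0, 1, …`; the entries `(k+1)'` and `k+1`, encoded by `2k` and `2k+1`,
both contribute one factor of the variable with index `k`. -/
noncomputable def weight (D : Finset (ℕ × ℕ)) (T : Filling) : ℕ →₀ ℕ :=
  ∑ p ∈ D, ∑ a ∈ T p, Finsupp.single (a / 2) 1

/-- The semistandard set-valued shifted tableaux of shape `lam/μ` and weight `x^m`. -/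
def tableauxQ (lam μ : StrictPartition) (m : ℕ →₀ ℕ) : Set Filling :=
  {T | IsSetShYTQ lam μ T ∧ weight (skewSD lam μ) T = m}

/-- Those without primed numbers on the diagonal. -/
def tableauxP (lam μ : StrictPartition) (m : ℕ →₀ ℕ) : Set Filling :=
  {T | IsSetShYTP lam μ T ∧ weight (skewSD lam μ) T = m}

theorem tableauxQ_finite (lam μ : StrictPartition) (m : ℕ →₀ ℕ) :
    (tableauxQ lam μ m).Finite := by
  classical
  obtain ⟨N, hN⟩ : ∃ N, ∀ k ∈ m.support, k < N :=
    ⟨m.support.sup id + 1, fun k hk => Nat.lt_succ_of_le (Finset.le_sup (f := id) hk)⟩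
  let D := skewSD lam μ
  let e : Filling → (D → Finset ℕ) := fun T p => T p
  refine Set.Finite.of_finite_image (f := e) ?_ ?_
  · have hfin : (Set.univ.pi fun _ : D =>
        ((Finset.range (2 * N)).powerset : Set (Finset ℕ))).Finite :=
      Set.Finite.pi fun _ => Finset.finite_toSet _
    refine hfin.subset ?_
    rintro _ ⟨T, ⟨-, hw⟩, rfl⟩ ⟨p, hp⟩ -
    simp only [Finset.coe_powerset, Set.mem_preimage, Set.mem_powerset_iff, Finset.coe_subset]
    intro a ha
    have h1 : a / 2 ∈ m.support := by
      rw [Finsupp.mem_support_iff, ← hw, weight, Finsupp.finsetSum_apply]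
      have h2 : 0 < (∑ b ∈ T p, Finsupp.single (b / 2) 1 : ℕ →₀ ℕ) (a / 2) := by
        rw [Finsupp.finsetSum_apply]
        exact Finset.sum_pos' (fun _ _ => Nat.zero_le _) ⟨a, ha, by simp⟩
      exact (Finset.sum_pos' (fun _ _ => Nat.zero_le _) ⟨p, hp, h2⟩).ne'
    have := hN _ h1
    simp only [Finset.mem_range]
    omega
  · rintro T ⟨hT, -⟩ T' ⟨hT', -⟩ h
    funext p
    by_cases hp : p ∈ D
    · exact congrFun h ⟨p, hp⟩
    · have h1 : ¬ (T p).Nonempty := fun h => hp ((hT.nonempty_iff p).1 h)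
      have h2 : ¬ (T' p).Nonempty := fun h => hp ((hT'.nonempty_iff p).1 h)
      rw [Finset.not_nonempty_iff_eq_empty] at h1 h2
      rw [h1, h2]

theorem tableauxP_finite (lam μ : StrictPartition) (m : ℕ →₀ ℕ) :
    (tableauxP lam μ m).Finite :=
  (tableauxQ_finite lam μ m).subset fun _ h => ⟨h.1.toIsSetShYTQ, h.2⟩

/-- The skew `K`-theoretic Schur `Q`-function `GQ_{lam/μ}` in `ℤ[β][[x_1, x_2, …]]`, given by its
coefficients; the variable `β` is `Polynomial.X`. -/
noncomputable def GQ (lam μ : StrictPartition) : MvPowerSeries ℕ (Polynomial ℤ) :=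
  fun m => ∑ T ∈ (tableauxQ_finite lam μ m).toFinset,
    Polynomial.X ^ (entryCount (skewSD lam μ) T - skewSize lam μ)

/-- The skew `K`-theoretic Schur `P`-function `GP_{lam/μ}`. -/
noncomputable def GP (lam μ : StrictPartition) : MvPowerSeries ℕ (Polynomial ℤ) :=
  fun m => ∑ T ∈ (tableauxP_finite lam μ m).toFinset,
    Polynomial.X ^ (entryCount (skewSD lam μ) T - skewSize lam μ)

open Classical in
/-- `GQ_{lam//μ}`, the sum of `β^{|μ/ν|} GQ_{lam/ν}` over the strict partitions `ν ⊆ μ` obtained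
by deleting removable boxes of `μ`; it is `0` unless `μ ⊆ lam`. -/
noncomputable def GQQ (lam μ : StrictPartition) : MvPowerSeries ℕ (Polynomial ℤ) :=
  if μ ≤ lam then
    ∑ ν ∈ (remSub_finite μ).toFinset, (Polynomial.X ^ skewSize μ ν : Polynomial ℤ) • GQ lam ν
  else 0

open Classical in
/-- `GP_{lam//μ}`, the sum of `β^{|μ/ν|} GP_{lam/ν}` over the strict partitions `ν ⊆ μ` obtained
by deleting removable boxes of `μ`; it is `0` unless `μ ⊆ lam`. -/
noncomputable def GPP (lam μ : StrictPartition) : MvPowerSeries ℕ (Polynomial ℤ) :=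
  if μ ≤ lam then
    ∑ ν ∈ (remSub_finite μ).toFinset, (Polynomial.X ^ skewSize μ ν : Polynomial ℤ) • GP lam ν
  else 0

/-- The inclusion of `ℤ[β][[x_1, x_2, …]]` into `ℚ[β][[x_1, x_2, …]]`. -/
noncomputable def toRat :
    MvPowerSeries ℕ (Polynomial ℤ) →+* MvPowerSeries ℕ (Polynomial ℚ) :=
  MvPowerSeries.map (Polynomial.mapRingHom (Int.castRingHom ℚ))

/-- The pairs `(κ, lam)` with `κ ⊆ ν ⊆ μ ⊆ lam` and `ℓ(κ) = ℓ(ν) ≤ ℓ(μ) = ℓ(lam)` such that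
`SD_{lam/μ}` is a vertical strip. -/
def skewPairs (ν μ : StrictPartition) : Set (StrictPartition × StrictPartition) :=
  {p | p.1 ≤ ν ∧ ν ≤ μ ∧ μ ≤ p.2 ∧ p.1.len = ν.len ∧ ν.len ≤ μ.len ∧ μ.len = p.2.len ∧
    IsVerticalStrip p.2 μ}

theorem skewPairs_finite (ν μ : StrictPartition) : (skewPairs ν μ).Finite := by
  refine ((finite_le ν).prod (finite_parts_zero_le (μ.parts 0 + 1))).subset ?_
  rintro ⟨κ, lam⟩ ⟨hκ, -, -, -, -, -, hv⟩
  refine ⟨hκ, ?_⟩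
  by_contra hlt
  have hlt' : ¬ lam.parts 0 ≤ μ.parts 0 + 1 := hlt
  have := hv 0 (μ.parts 0) (μ.parts 0 + 1)
    (by simp only [skewSD, Finset.mem_sdiff, mem_SD]; omega)
    (by simp only [skewSD, Finset.mem_sdiff, mem_SD]; omega)
  omega

end StrictPartition

/-! ### Strict partitions as sequences, and the transfer recursion -/

namespace StrictPartition

/-! Both sides are read as entries of matrices indexed by strict partitions. Choosing `ρ` in the
definition of $GQ_{\mu/\!/\nu}$ and then a tableau of shape `μ/ρ` amounts to filling `μ/ν` with
nonempty sets while the removable boxes of `ν` may carry entries as well; the powers of β combine to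
$|T|-|\mu/\nu|$. In this form splitting off the largest letter is a matrix product
(`tableauSum_succ`), so in finitely many variables the generating function is a product of
one-variable matrices $W_Q(x_k)$, and of matrices $W_P(x_k)$ for $GP$. A fixed coefficient only sees
finitely many variables.

Put $b=-\beta/2$. Let $A(\nu,\kappa)=2^{\ell(\nu)}(-1)^{\mathsf{cols}(\kappa/\nu)}b^{|\kappa/\nu|}$
if `κ/ν` is a vertical strip and the lengths agree, and $0$ otherwise. The heart of the proof is the
intertwining relation $W_Q(x)A=A\,W_P(x)$ (`sum_prod_weightL_eq`). Iterated over the variables it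
gives $GQ\cdot A=A\cdot GP$ (`sum_tableauSum_mul_basisChange`). Moreover $AB=1$ for
$B(\kappa,\nu)=2^{-\ell(\nu)}2^{\mathsf{overlap}(\nu/\kappa)}b^{|\nu/\kappa|}$, with
$\kappa\subseteq\nu$ of equal length (`sum_prod_weightInv`). Hence $GQ=A\cdot GP\cdot B$, which is
the theorem written entry by entry.

The entries of $W$, $A$ and $B$ are products over rows of weights that depend only on the lengths of
that row and the next. A sum over an intermediate partition is therefore a transfer recursion
(`chain`), evaluated upwards from the empty rows at the bottom. In $W_QA$ the intermediate row has
length $\kappa_i$ or $\kappa_i-1$, in $AW_P$ it has length $\mu_i$ or $\mu_i+1$, so four partial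
sums describe the state. `Balanced` is a relation between them that survives the addition of a row
and forces the two totals to agree; `Cancels` plays the same role for $AB=1$. -/

theorem parts_succ_le (μ : StrictPartition) (i : ℕ) : μ.parts (i + 1) ≤ μ.parts i := by
  rcases Nat.eq_zero_or_pos (μ.parts i) with h | h
  · simp [μ.zero_of_zero i h]
  · exact (μ.lt_of_pos i h).le

theorem parts_antitone (μ : StrictPartition) : Antitone μ.parts :=
  antitone_nat_of_succ_le μ.parts_succ_le

/-- The relation between consecutive parts of a strict partition. -/
def Descends (a b : ℕ) : Prop := b < a ∨ (a = 0 ∧ b = 0)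

instance (a b : ℕ) : Decidable (Descends a b) := inferInstanceAs (Decidable (_ ∨ _))

theorem descends (μ : StrictPartition) (i : ℕ) : Descends (μ.parts i) (μ.parts (i + 1)) := by
  rcases Nat.eq_zero_or_pos (μ.parts i) with h | h
  · exact Or.inr ⟨h, μ.zero_of_zero i h⟩
  · exact Or.inl (μ.lt_of_pos i h)

/-- A sequence whose consecutive entries descend is a strict partition. -/
def ofDescends (f : ℕ → ℕ) (h : ∀ i, Descends (f i) (f (i + 1))) : StrictPartition where
  parts := f
  lt_of_pos i hi := by have := h i; unfold Descends at this; omega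
  zero_of_zero i hi := by have := h i; unfold Descends at this; omega

/-- Removal of the first part. -/
def tail (μ : StrictPartition) : StrictPartition :=
  ofDescends (fun i => μ.parts (i + 1)) fun i => μ.descends (i + 1)

/-- Insertion of a new first part. -/
def cons (a : ℕ) (μ : StrictPartition) (h : Descends a (μ.parts 0)) : StrictPartition :=
  ofDescends (fun i => Nat.casesOn i a μ.parts) fun i => by
    cases i with
    | zero => exact h
    | succ i => exact μ.descends i

@[simp] theorem tail_parts (μ : StrictPartition) (i : ℕ) : μ.tail.parts i = μ.parts (i + 1) := rfl

@[simp] theorem cons_parts_zero (a : ℕ) (μ : StrictPartition) (h) : (cons a μ h).parts 0 = a := rfl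

@[simp] theorem cons_parts_succ (a : ℕ) (μ : StrictPartition) (h) (i : ℕ) :
    (cons a μ h).parts (i + 1) = μ.parts i := rfl

theorem parts_eq_zero_of_le (μ : StrictPartition) {i : ℕ} (h : μ.parts 0 ≤ i) :
    μ.parts i = 0 := by
  by_contra h0
  have := μ.parts_add_le i (by omega)
  omega

/-- The strict partitions with parts at most `M`. -/
noncomputable def bounded (M : ℕ) : Finset StrictPartition := (finite_parts_zero_le M).toFinset

@[simp] theorem mem_bounded {M : ℕ} {μ : StrictPartition} : μ ∈ bounded M ↔ μ.parts 0 ≤ M := by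
  simp [bounded]

variable {R : Type*} [CommRing R]

/-- The transfer recursion for sums over strict partitions of products of weights `W i a b` that
depend on the index `i` of a part, on the part `a` and on the next part `b`. -/
def chain (M : ℕ) (W : ℕ → ℕ → ℕ → R) : ℕ → ℕ → ℕ → R
  | 0, _, a => if a = 0 then 1 else 0
  | k + 1, i, a =>
    ∑ b ∈ Finset.range (M + 1), if Descends a b then W i a b * chain M W k (i + 1) b else 0

/-- Grouping by the second part and removing the first one (`tail`, with inverse `cons`) reproduces
the recursion of `chain`. -/
theorem sum_filter_eq_chain (M : ℕ) (W : ℕ → ℕ → ℕ → R) (k i a : ℕ) (ha : a ≤ M) :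
    ∑ ν ∈ (bounded M).filter (fun ν => ν.parts 0 = a ∧ ν.parts k = 0),
      ∏ j ∈ Finset.range k, W (i + j) (ν.parts j) (ν.parts (j + 1)) = chain M W k i a := by
  induction k generalizing i a with
  | zero =>
    simp only [chain, Finset.range_zero, Finset.prod_empty]
    split_ifs with h
    · subst h
      rw [Finset.sum_const, nsmul_one]
      have : (bounded M).filter (fun ν => ν.parts 0 = 0 ∧ ν.parts 0 = 0) =
          {ofDescends (fun _ => 0) fun _ => Or.inr ⟨rfl, rfl⟩} := by
        ext ν
        simp only [Finset.mem_filter, mem_bounded, and_self, Finset.mem_singleton]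
        constructor
        · rintro ⟨_, h⟩
          ext j
          exact parts_eq_zero_of_le ν (by omega)
        · rintro rfl
          simp [ofDescends]
      rw [this]
      simp
    · rw [Finset.filter_false_of_mem, Finset.sum_empty]
      rintro ν - ⟨h1, h2⟩
      omega
  | succ k ih =>
    rw [chain, ← Finset.sum_fiberwise_of_maps_to (g := fun ν => ν.parts 1)
      (t := Finset.range (M + 1))]
    · refine Finset.sum_congr rfl fun b hb => ?_
      rw [Finset.filter_filter]
      split_ifs with hab
      · rw [← ih (i + 1) b (by simpa [Nat.lt_succ_iff] using hb), Finset.mul_sum]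
        refine Finset.sum_bij' (fun ν _ => ν.tail)
          (fun ν hν => cons a ν (by simp at hν; rwa [hν.2.1])) ?_ ?_ ?_ ?_ ?_
        · intro ν hν
          simp only [Finset.mem_filter, mem_bounded, tail_parts] at hν ⊢
          simp only [Finset.mem_range] at hb
          exact ⟨by rw [hν.2.2]; omega, hν.2.2, hν.2.1.2⟩
        · intro ν hν
          simp only [Finset.mem_filter, mem_bounded, cons_parts_zero, cons_parts_succ] at hν ⊢
          exact ⟨ha, ⟨trivial, hν.2.2⟩, hν.2.1⟩
        · intro ν hν
          simp only [Finset.mem_filter] at hν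
          ext j
          cases j with
          | zero => exact hν.2.1.1.symm
          | succ j => rfl
        · intro ν hν
          ext j
          rfl
        · intro ν hν
          simp only [Finset.mem_filter] at hν
          rw [Finset.prod_range_succ']
          simp only [tail_parts, add_zero, hν.2.1.1, hν.2.2, zero_add]
          rw [mul_comm]
          congr 1
          refine Finset.prod_congr rfl fun j _ => ?_
          rw [show i + (j + 1) = i + 1 + j by omega]
      · rw [Finset.filter_false_of_mem, Finset.sum_empty]
        rintro ν - ⟨h1, h2⟩
        exact hab (by rw [← h1.1, ← h2]; exact ν.descends 0)
    · intro ν hν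
      simp only [Finset.mem_filter, mem_bounded, Finset.mem_range] at hν ⊢
      have := ν.parts_succ_le 0
      simp only [zero_add] at this
      omega

theorem sum_bounded_eq_chain (M : ℕ) (W : ℕ → ℕ → ℕ → R) (n : ℕ) (hn : M ≤ n) :
    ∑ ν ∈ bounded M, ∏ j ∈ Finset.range n, W j (ν.parts j) (ν.parts (j + 1)) =
      ∑ a ∈ Finset.range (M + 1), chain M W n 0 a := by
  rw [← Finset.sum_fiberwise_of_maps_to (g := fun ν => ν.parts 0) (t := Finset.range (M + 1))
    (by intro ν hν; simpa [Nat.lt_succ_iff] using hν)]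
  refine Finset.sum_congr rfl fun a ha => ?_
  rw [← sum_filter_eq_chain M W n 0 a (by simpa [Nat.lt_succ_iff] using ha)]
  refine Finset.sum_congr ?_ fun ν _ => by simp
  ext ν
  simp only [Finset.mem_filter, mem_bounded]
  constructor
  · rintro ⟨h1, h2⟩
    exact ⟨h1, h2, ν.parts_eq_zero_of_le (by omega)⟩
  · rintro ⟨h1, h2, _⟩
    exact ⟨h1, h2⟩

end StrictPartition
-- Row weights of the one-letter and one-variable matrices
namespace StrictPartition
variable {R : Type*} [CommRing R]

/-- The contribution of a row to the one-letter matrix of a primed letter: the row grows from length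
`n` to length `m`, and the next row has length `n₁` before it grows. If `f` holds, then the letter
is not allowed on the diagonal. -/
def vrow (f : Bool) (x b : R) (m n n₁ : ℕ) : R :=
  if n ≤ m ∧ m ≤ n + 1 ∧ ¬ (f = true ∧ n = 0 ∧ m = 1) then
    x ^ (m - n) * (if m = n ∧ 0 < n ∧ (n₁ + 1 < n ∨ n = 1) ∧ ¬ (f = true ∧ n = 1)
      then 1 - 2 * (b * x) else 1)
  else 0

/-- The contribution of a row to the one-letter matrix of an unprimed letter: the row grows from
length `n` to length `m`, and the next row has length `m₁` after it has grown. -/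
def hrow (x b : R) (m n m₁ : ℕ) : R :=
  if n ≤ m ∧ (m₁ < n ∨ m₁ = 0) then
    x ^ (m - n) * (if 0 < n ∧ (m₁ + 1 < n ∨ n = 1) then 1 - 2 * (b * x) else 1)
  else 0

/-- The contribution of a row to the one-variable matrix: the row grows from length `n` to length
`m`, the next row from `n₁` to `m₁`. -/
def wrow (f : Bool) (x b : R) (m n m₁ n₁ : ℕ) : R :=
  hrow x b m n m₁ * vrow f x b n n n₁ + hrow x b m (n + 1) m₁ * vrow f x b (n + 1) n n₁

section
variable {x b : R} {m n m₁ n₁ : ℕ}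

theorem vrow_false : vrow false x b m n n₁ = if n ≤ m ∧ m ≤ n + 1 then
    x ^ (m - n) * (if m = n ∧ 0 < n ∧ (n₁ + 1 < n ∨ n = 1) then 1 - 2 * (b * x) else 1)
    else 0 := by
  simp [vrow]

theorem vrow_true : vrow true x b m n n₁ = if n ≤ m ∧ m ≤ n + 1 ∧ ¬ (n = 0 ∧ m = 1) then
    x ^ (m - n) * (if m = n ∧ 0 < n ∧ (n₁ + 1 < n ∨ n = 1) ∧ ¬ n = 1
      then 1 - 2 * (b * x) else 1) else 0 := by
  simp [vrow]

/-- This and the following lemmas tabulate `wrow`. The names compare the inner length `n` with the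
next outer length `m₁`: far means a gap of at least 2, near a gap of 1, touch a gap of 0; `fixed`
says that the next row does not grow, `self` that this row does not grow. The flag `f` matters only
for `n ≤ 1`, where the diagonal box is involved; these cases are listed separately. -/
theorem wrow_of_not {f : Bool} (h : m < n ∨ n < m₁) : wrow f x b m n m₁ n₁ = 0 := by
  simp (disch := omega) only [wrow, hrow, if_neg, zero_mul, add_zero]

theorem pow_sub_eq_pow_sub_succ_mul (h : n < m) : x ^ (m - n) = x ^ (m - (n + 1)) * x := by
  rw [← pow_succ]; congr 1; omega

theorem wrow_far {f : Bool} (h : n < m) (h₁ : m₁ + 2 ≤ n) (h₂ : n₁ + 2 ≤ n) :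
    wrow f x b m n m₁ n₁ = x ^ (m - n) * (2 * (1 - b * x) * (1 - 2 * (b * x))) := by
  cases f <;> simp (disch := omega) only [wrow, hrow, vrow_true, vrow_false, if_pos, if_neg, true_and, or_true, and_true, not_true_eq_false, and_false, if_true, if_false, pow_sub_eq_pow_sub_succ_mul h, Nat.add_sub_cancel_left, Nat.sub_self] <;> ring

theorem wrow_far_self {f : Bool} (h : m = n) (h₁ : m₁ + 2 ≤ n) (h₂ : n₁ + 2 ≤ n) :
    wrow f x b m n m₁ n₁ = (1 - 2 * (b * x)) * (1 - 2 * (b * x)) := by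
  subst h
  cases f <;> simp (disch := omega) only [wrow, hrow, vrow_true, vrow_false, if_pos, if_neg, true_and, or_true, and_true, not_true_eq_false, and_false, if_true, if_false, Nat.sub_self, Nat.sub_zero] <;> ring

theorem wrow_near {f : Bool} (h : n < m) (h₁ : m₁ + 1 = n) (h₂ : n₁ < m₁) :
    wrow f x b m n m₁ n₁ = x ^ (m - n) * (2 * (1 - 2 * (b * x))) := by
  cases f <;> simp (disch := omega) only [wrow, hrow, vrow_true, vrow_false, if_pos, if_neg, true_and, or_true, and_true, not_true_eq_false, and_false, if_true, if_false, pow_sub_eq_pow_sub_succ_mul h, Nat.add_sub_cancel_left, Nat.sub_self] <;> ring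

theorem wrow_near_self {f : Bool} (h : m = n) (h₁ : m₁ + 1 = n) (h₂ : n₁ < m₁) :
    wrow f x b m n m₁ n₁ = (1 - 2 * (b * x)) := by
  subst h
  cases f <;> simp (disch := omega) only [wrow, hrow, vrow_true, vrow_false, if_pos, if_neg, true_and, or_true, and_true, not_true_eq_false, and_false, if_true, if_false, Nat.sub_self, Nat.sub_zero] <;> ring

theorem wrow_near_fixed {f : Bool} (h : n < m) (h₁ : m₁ + 1 = n) (h₂ : n₁ = m₁) (h₀ : 0 < m₁) :
    wrow f x b m n m₁ n₁ = x ^ (m - n) * (2 * (1 - b * x)) := by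
  subst h₂
  cases f <;> simp (disch := omega) only [wrow, hrow, vrow_true, vrow_false, if_pos, if_neg, true_and, or_true, and_true, not_true_eq_false, and_false, if_true, if_false, pow_sub_eq_pow_sub_succ_mul h, Nat.add_sub_cancel_left, Nat.sub_self] <;> ring

theorem wrow_near_fixed_self {f : Bool} (h : m = n) (h₁ : m₁ + 1 = n) (h₂ : n₁ = m₁) (h₀ : 0 < m₁) :
    wrow f x b m n m₁ n₁ = 1 := by
  subst h h₂
  cases f <;> simp (disch := omega) only [wrow, hrow, vrow_true, vrow_false, if_pos, if_neg, true_and, or_true, and_true, not_true_eq_false, and_false, if_true, if_false, Nat.sub_self, Nat.sub_zero] <;> ring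

theorem wrow_touch {f : Bool} (h : n < m) (h₁ : m₁ = n) (h₀ : 0 < n) :
    wrow f x b m n m₁ n₁ = x ^ (m - n) := by
  cases f <;> simp (disch := omega) only [wrow, hrow, vrow_true, vrow_false, if_pos, if_neg, true_and, or_true, and_true, not_true_eq_false, and_false, if_true, if_false, pow_sub_eq_pow_sub_succ_mul h, Nat.add_sub_cancel_left, Nat.sub_self] <;> ring

theorem wrow_zero_self {f : Bool} (h : m = 0) (h₀ : n = 0) (h₁ : m₁ = 0) (h₂ : n₁ = 0) :
    wrow f x b m n m₁ n₁ = 1 := by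
  subst h h₀ h₁ h₂
  cases f <;> simp (disch := omega) only [wrow, hrow, vrow_true, vrow_false, if_pos, if_neg, true_and, or_true, and_true, not_true_eq_false, and_false, if_true, if_false, Nat.sub_self, Nat.sub_zero] <;> ring

theorem wrow_false_zero (h : 0 < m) (h₀ : n = 0) (h₁ : m₁ = 0) (h₂ : n₁ = 0) :
    wrow false x b m n m₁ n₁ = x ^ (m - n) * (2 * (1 - b * x)) := by
  subst h₀ h₁ h₂
  have := pow_sub_eq_pow_sub_succ_mul (x := x) h
  simp only [Nat.sub_zero] at this
  simp (disch := omega) only [wrow, hrow, vrow_true, vrow_false, if_pos, if_neg, true_and, or_true, and_true, not_true_eq_false, and_false, if_true, if_false, Nat.sub_zero, this, Nat.add_sub_cancel_left, Nat.sub_self]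
  ring

theorem wrow_true_zero (h : 0 < m) (h₀ : n = 0) (h₁ : m₁ = 0) (h₂ : n₁ = 0) :
    wrow true x b m n m₁ n₁ = x ^ (m - n) := by
  subst h₀ h₁ h₂
  simp (disch := omega) only [wrow, hrow, vrow_true, vrow_false, if_pos, if_neg, true_and, or_true, and_true, not_true_eq_false, and_false, if_true, if_false, Nat.sub_self, Nat.sub_zero]
  ring

theorem wrow_false_one (h : 1 < m) (h₀ : n = 1) (h₁ : m₁ = 0) (h₂ : n₁ = 0) :
    wrow false x b m n m₁ n₁ = x ^ (m - n) * (2 * (1 - b * x) * (1 - 2 * (b * x))) := by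
  subst h₀ h₁ h₂
  simp (disch := omega) only [wrow, hrow, vrow_true, vrow_false, if_pos, if_neg, true_and, or_true, and_true, not_true_eq_false, and_false, if_true, if_false, pow_sub_eq_pow_sub_succ_mul h, Nat.add_sub_cancel_left, Nat.sub_self]
  ring

theorem wrow_true_one (h : 1 < m) (h₀ : n = 1) (h₁ : m₁ = 0) (h₂ : n₁ = 0) :
    wrow true x b m n m₁ n₁ = x ^ (m - n) * (2 * (1 - 2 * (b * x))) := by
  subst h₀ h₁ h₂
  simp (disch := omega) only [wrow, hrow, vrow_true, vrow_false, if_pos, if_neg, true_and, or_true, and_true, not_true_eq_false, and_false, if_true, if_false, pow_sub_eq_pow_sub_succ_mul h, Nat.add_sub_cancel_left, Nat.sub_self]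
  ring

theorem wrow_false_one_self (h : m = 1) (h₀ : n = 1) (h₁ : m₁ = 0) (h₂ : n₁ = 0) :
    wrow false x b m n m₁ n₁ = (1 - 2 * (b * x)) * (1 - 2 * (b * x)) := by
  subst h h₀ h₁ h₂
  simp (disch := omega) only [wrow, hrow, vrow_true, vrow_false, if_pos, if_neg, true_and, or_true, and_true, not_true_eq_false, and_false, if_true, if_false, Nat.sub_self, Nat.sub_zero]
  ring

theorem wrow_true_one_self (h : m = 1) (h₀ : n = 1) (h₁ : m₁ = 0) (h₂ : n₁ = 0) :
    wrow true x b m n m₁ n₁ = (1 - 2 * (b * x)) := by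
  subst h h₀ h₁ h₂
  simp (disch := omega) only [wrow, hrow, vrow_true, vrow_false, if_pos, if_neg, true_and, or_true, and_true, not_true_eq_false, and_false, if_true, if_false, Nat.sub_self, Nat.sub_zero]
  ring

end
end StrictPartition
-- Row weights of the change of basis and the invariant of the intertwining identity
namespace StrictPartition
variable {R : Type*} [CommRing R]

/-- The contribution of a row to the entries of the change of basis matrix: the row grows from
length `n` to length `k`, the next row from `n₁` to `k₁`. -/
def arow (b : R) (n k n₁ k₁ : ℕ) : R :=
  if n ≤ k ∧ k ≤ n + 1 ∧ (n = 0 ↔ k = 0) then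
    (if 0 < n then 2 else 1) *
      (if k = n + 1 then (if k₁ = n₁ + 1 ∧ n = n₁ + 1 then b else -b) else 1)
  else 0

/-- The relation between the partial sums of the two sides of the intertwining identity, where
the rows from some index on are summed over, the first of these rows has length `m` in the upper and
`k` in the lower partition, and `L₀`, `L₁` (`R₀`, `R₁`) are the sums over those configurations
where the first row does not change, or changes. -/
def Balanced (z : R) (m k : ℕ) (L₀ L₁ R₀ R₁ : R) : Prop :=
  (k ≤ 1 → L₁ = 0) ∧ (m = 0 → R₁ = 0) ∧ (m + 1 < k → L₀ = 0 ∧ L₁ = 0 ∧ R₀ = 0 ∧ R₁ = 0) ∧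
  (k = m + 1 → L₀ = 0 ∧ R₀ = 0 ∧ L₁ = R₁) ∧
  (k = m → k = 0 → L₀ = R₀ ∧ L₁ = 0 ∧ R₁ = 0) ∧
  (k = m → 0 < k → ∃ A B, L₀ = (1 - 2 * z) * A ∧ L₁ = (1 - z) * B ∧ R₀ = A + B ∧
    R₁ = -(2 * z * A) - z * B ∧ (k = 1 → B = 0)) ∧
  (k < m → L₀ + L₁ = (1 - z) * R₀ ∧ R₁ = -(z * R₀))

/-- At the top row only the totals matter. The finer relation is needed lower down, because the next
row weighs `L₀` and `L₁` (and `R₀` and `R₁`) differently when it is close to the row below. -/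
theorem Balanced.add_eq_add {z : R} {m k : ℕ} {L₀ L₁ R₀ R₁ : R}
    (h : Balanced z m k L₀ L₁ R₀ R₁) : L₀ + L₁ = R₀ + R₁ := by
  obtain ⟨-, -, hA, hB, hC, hD, hE⟩ := h
  rcases lt_trichotomy k m with h | h | h
  · obtain ⟨h1, h2⟩ := hE h
    rw [h1, h2]; ring
  · rcases Nat.eq_zero_or_pos k with h0 | h0
    · obtain ⟨h1, h2, h3⟩ := hC h h0
      rw [h1, h2, h3]
    · obtain ⟨A, B, h1, h2, h3, h4, -⟩ := hD h h0
      rw [h1, h2, h3, h4]; ring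
  · rcases Nat.lt_or_ge (m + 1) k with h' | h'
    · obtain ⟨h1, h2, h3, h4⟩ := hA h'
      rw [h1, h2, h3, h4]
    · obtain ⟨h1, h2, h3⟩ := hB (by omega)
      rw [h1, h2, h3]

/-- One step of the transfer recursion for the lower partition, where the new row has length `a`. -/
def stepL (x b : R) (m k m₁ k₁ : ℕ) (L₀ L₁ : R) (a : ℕ) : R :=
  (if k₁ < a ∨ (a = 0 ∧ k₁ = 0) then
    wrow false x b m a m₁ k₁ * arow b a k k₁ k₁ * L₀ else 0) +
  (if 2 ≤ k₁ ∧ k₁ - 1 < a then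
    wrow false x b m a m₁ (k₁ - 1) * arow b a k (k₁ - 1) k₁ * L₁ else 0)

/-- One step of the transfer recursion for the upper partition, where the new row has length `a`. -/
def stepR (x b : R) (m k m₁ k₁ : ℕ) (R₀ R₁ : R) (a : ℕ) : R :=
  (if m₁ < a ∨ (a = 0 ∧ m₁ = 0) then
    arow b m a m₁ m₁ * wrow true x b a k m₁ k₁ * R₀ else 0) +
  (if 1 ≤ m₁ ∧ m₁ + 1 < a then
    arow b m a m₁ (m₁ + 1) * wrow true x b a k (m₁ + 1) k₁ * R₁ else 0)

variable {x b : R} {m k m₁ k₁ : ℕ} {L₀ L₁ R₀ R₁ : R}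

theorem arow_self_zero (b : R) {n k : ℕ} (n₁ k₁ : ℕ) (h : n = 0) (h' : k = 0) :
    arow b n k n₁ k₁ = 1 := by
  simp [arow, h, h']

theorem arow_self (b : R) {n k : ℕ} (n₁ k₁ : ℕ) (h : 0 < n) (h' : k = n) :
    arow b n k n₁ k₁ = 2 := by
  subst h'
  simp [arow, h]

theorem arow_grow (b : R) {n k n₁ k₁ : ℕ} (h : 0 < n) (hk : k = n + 1)
    (h' : k₁ ≠ n₁ + 1 ∨ n ≠ n₁ + 1) : arow b n k n₁ k₁ = -(2 * b) := by
  simp (disch := omega) only [arow, if_pos, if_neg]; ring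

theorem arow_grow_stacked (b : R) {n k n₁ k₁ : ℕ} (h : 0 < n) (hk : k = n + 1) (h' : k₁ = n₁ + 1)
    (h'' : n = n₁ + 1) : arow b n k n₁ k₁ = 2 * b := by
  simp (disch := omega) only [arow, if_pos, if_neg]

theorem arow_of_not (b : R) {n k n₁ k₁ : ℕ} (h : k < n ∨ n + 1 < k ∨ (n = 0 ∧ 0 < k)) :
    arow b n k n₁ k₁ = 0 := by
  simp (disch := omega) only [arow, if_neg]

theorem pow_eq_self {x : R} {n : ℕ} (h : n = 1) : x ^ n = x := by rw [h, pow_one]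

theorem pow_eq_one {x : R} {n : ℕ} (h : n = 0) : x ^ n = 1 := by rw [h, pow_zero]

/-- The invariant is solved for the sums that can be eliminated, with lengths 0 and 1 split off, so
that each alternative can be substituted directly into the step identities. -/
theorem Balanced.cases {z : R} (h : Balanced z m k L₀ L₁ R₀ R₁) :
    (m + 1 < k ∧ L₀ = 0 ∧ L₁ = 0 ∧ R₀ = 0 ∧ R₁ = 0) ∨
    (k = m + 1 ∧ 0 < m ∧ L₀ = 0 ∧ R₀ = 0 ∧ L₁ = R₁) ∨
    (k = 1 ∧ m = 0 ∧ L₀ = 0 ∧ R₀ = 0 ∧ L₁ = 0 ∧ R₁ = 0) ∨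
    (k = 0 ∧ m = 0 ∧ L₀ = R₀ ∧ L₁ = 0 ∧ R₁ = 0) ∨
    (k = m ∧ 1 < m ∧ ∃ A B, L₀ = (1 - 2 * z) * A ∧ L₁ = (1 - z) * B ∧ R₀ = A + B ∧
      R₁ = -(2 * z * A) - z * B) ∨
    (k = 1 ∧ m = 1 ∧ L₀ = (1 - 2 * z) * R₀ ∧ L₁ = 0 ∧ R₁ = -(2 * z * R₀)) ∨
    (k < m ∧ 1 < k ∧ L₀ = (1 - z) * R₀ - L₁ ∧ R₁ = -(z * R₀)) ∨
    (k < m ∧ k ≤ 1 ∧ L₁ = 0 ∧ L₀ = (1 - z) * R₀ ∧ R₁ = -(z * R₀)) := by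
  obtain ⟨h1, h2, hA, hB, hC, hD, hE⟩ := h
  rcases lt_trichotomy k m with h | h | h
  · obtain ⟨h3, h4⟩ := hE h
    iterate 6 right
    rcases Nat.lt_or_ge 1 k with h' | h'
    · exact Or.inl ⟨h, h', by rw [← h3]; ring, h4⟩
    · rw [h1 h', add_zero] at h3
      exact Or.inr ⟨h, h', h1 h', h3, h4⟩
  · iterate 3 right
    rcases Nat.eq_zero_or_pos k with h0 | h0
    · exact Or.inl ⟨h0, by omega, hC h h0⟩
    · obtain ⟨A, B, h3, h4, h5, h6, h7⟩ := hD h h0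
      rcases Nat.lt_or_ge 1 k with h' | h'
      · exact Or.inr (Or.inl ⟨h, by omega, A, B, h3, h4, h5, h6⟩)
      · have hB := h7 (by omega)
        subst hB
        refine Or.inr (Or.inr (Or.inl ⟨by omega, by omega, ?_, h1 h', ?_⟩))
        · rw [h3, h5, add_zero]
        · rw [h6, h5]; ring
  · rcases Nat.lt_or_ge (m + 1) k with h' | h'
    · exact Or.inl ⟨h', hA h'⟩
    · right
      have : k = m + 1 := by omega
      obtain ⟨h3, h4, h5⟩ := hB this
      rcases Nat.eq_zero_or_pos m with h0 | h0
      · have h6 := h1 (by omega)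
        exact Or.inr (Or.inl ⟨by omega, h0, h3, h4, h6, by rw [← h5, h6]⟩)
      · exact Or.inl ⟨this, h0, h3, h4, h5⟩

/-- Each side has a single possible top row: on the left the lower row is shortened to `m`, on the
right the upper row is lengthened to `m + 1`. In both cases the one-variable matrix leaves this row
unchanged. -/
theorem Balanced.step_grow (h : Balanced (b * x) m₁ k₁ L₀ L₁ R₀ R₁)
    (hm : m₁ < m ∨ (m = 0 ∧ m₁ = 0)) (hk : k₁ < k ∨ (k = 0 ∧ k₁ = 0)) (hkm : k = m + 1) (h0 : 0 < m) :
    stepL x b m k m₁ k₁ L₀ L₁ (k - 1) = stepR x b m k m₁ k₁ R₀ R₁ (m + 1) := by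
  subst hkm
  rw [Nat.add_sub_cancel]
  have hg : m = 1 ∨ (m = m₁ + 1 ∧ 1 < m) ∨ (m₁ + 2 ≤ m) := by omega
  have hg' : k₁ = m ∨ (k₁ + 1 = m) ∨ (k₁ + 2 ≤ m) := by omega
  have hd: m₁ = 0 ∨ 1 ≤ m₁ := by omega
  rcases h.cases with ⟨h1, rfl, rfl, rfl, rfl⟩ | ⟨h1, h2, rfl, rfl, rfl⟩ |
    ⟨h1, h2, rfl, rfl, rfl, rfl⟩ | ⟨h1, h2, rfl, rfl, rfl⟩ |
    ⟨h1, h2, A, B, rfl, rfl, rfl, rfl⟩ | ⟨h1, h2, rfl, rfl, rfl⟩ |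
    ⟨h1, h2, rfl, rfl⟩ | ⟨h1, h2, rfl, rfl, rfl⟩ <;>
  rcases hg with hg | ⟨hg, hg2⟩ | hg <;> rcases hg' with hg' | hg' | hg' <;> rcases hd with hd | hd <;>
  first | (exfalso; omega) | skip
  all_goals simp (disch := omega) only [stepL, stepR, if_pos, if_neg, wrow_of_not, wrow_far, wrow_far_self, wrow_near, wrow_near_self, wrow_near_fixed, wrow_near_fixed_self, wrow_touch, wrow_zero_self, wrow_false_zero, wrow_true_zero, wrow_false_one, wrow_true_one, wrow_false_one_self, wrow_true_one_self, arow_self_zero, arow_self, arow_grow, arow_grow_stacked, arow_of_not, pow_eq_self, pow_eq_one, lt_irrefl, false_and, if_false, true_and, or_true, true_or, if_true, and_true, or_false, false_or, le_refl, mul_zero, zero_mul, add_zero, zero_add]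
  all_goals ring

set_option maxHeartbeats 2000000 in
-- Lengthening the upper row costs `-b` from `arow` and one more `x` from `wrow`, hence the factor
-- `-(b * x)`. The exceptional sign of stacked boxes plays no role: it needs `m = m₁ + 1`, and then
-- the next row would grow to a length exceeding `k`, where `wrow` vanishes.
theorem Balanced.step_shrink (h : Balanced (b * x) m₁ k₁ L₀ L₁ R₀ R₁)
    (hm : m₁ < m ∨ (m = 0 ∧ m₁ = 0)) (hk : k₁ < k ∨ (k = 0 ∧ k₁ = 0)) (hkm : k < m) :
    stepL x b m k m₁ k₁ L₀ L₁ k + (if 2 ≤ k then stepL x b m k m₁ k₁ L₀ L₁ (k - 1) else 0) =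
      (1 - b * x) * stepR x b m k m₁ k₁ R₀ R₁ m ∧
    stepR x b m k m₁ k₁ R₀ R₁ (m + 1) = -(b * x * stepR x b m k m₁ k₁ R₀ R₁ m) := by
  have e1 : x ^ (m + 1 - k) = x ^ (m - k) * x := by rw [← pow_succ]; congr 1; omega
  have e2 : 2 ≤ k → x ^ (m - (k - 1)) = x ^ (m - k) * x := fun _ => by
    rw [← pow_succ]; congr 1; omega
  have hg : k = 0 ∨ k = 1 ∨ 2 ≤ k := by omega
  have hd : m₁ = 0 ∨ 1 ≤ m₁ := by omega
  have he : m = m₁ + 1 ∨ m₁ + 2 ≤ m := by omega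
  -- These ranges decide which entry of the table for `wrow` applies when the inner length `k` or `k
  -- - 1` meets the next outer length `m₁` or `m₁ + 1`.
  have hf : k < m₁ ∨ k = m₁ ∨ k = m₁ + 1 ∨ k = m₁ + 2 ∨ m₁ + 3 ≤ k := by omega
  rcases h.cases with ⟨h1, rfl, rfl, rfl, rfl⟩ | ⟨h1, h2, rfl, rfl, rfl⟩ |
    ⟨h1, h2, rfl, rfl, rfl, rfl⟩ | ⟨h1, h2, rfl, rfl, rfl⟩ |
    ⟨h1, h2, A, B, rfl, rfl, rfl, rfl⟩ | ⟨h1, h2, rfl, rfl, rfl⟩ |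
    ⟨h1, h2, rfl, rfl⟩ | ⟨h1, h2, rfl, rfl, rfl⟩ <;>
  rcases hg with hg | hg | hg <;> rcases hd with hd | hd <;> rcases he with he | he <;>
  rcases hf with hf | hf | hf | hf | hf <;>
  first | (exfalso; omega) | skip
  all_goals simp (disch := omega) only [stepL, stepR, if_pos, if_neg, wrow_of_not, wrow_far, wrow_far_self, wrow_near, wrow_near_self, wrow_near_fixed, wrow_near_fixed_self, wrow_touch, wrow_zero_self, wrow_false_zero, wrow_true_zero, wrow_false_one, wrow_true_one, wrow_false_one_self, wrow_true_one_self, arow_self_zero, arow_self, arow_grow, arow_grow_stacked, arow_of_not, pow_eq_self, pow_eq_one, lt_irrefl, false_and, if_false, true_and, or_true, true_or, if_true, and_true, or_false, false_or, le_refl, mul_zero, zero_mul, add_zero, zero_add, e1, e2, neg_zero, and_self, ite_self]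
  all_goals refine ⟨?_, ?_⟩ <;> ring

end StrictPartition
namespace StrictPartition
variable {R : Type*} [CommRing R]
variable {x b : R} {m k m₁ k₁ : ℕ} {L₀ L₁ R₀ R₁ : R}

/-- The witnesses are the two left sums with the factors `1 - 2 * (b * x)` and `1 - b * x`
cancelled. They are given explicitly because `R` is an arbitrary commutative ring, where
cancellation is not available; the two formulas for the right sums are then polynomial identities.
-/
theorem Balanced.step_self (h : Balanced (b * x) m₁ k₁ L₀ L₁ R₀ R₁)
    (hm : m₁ < m ∨ (m = 0 ∧ m₁ = 0)) (hk : k₁ < k ∨ (k = 0 ∧ k₁ = 0)) (hkm : k = m) (h0 : 0 < m) :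
    ∃ A B, stepL x b m k m₁ k₁ L₀ L₁ k = (1 - 2 * (b * x)) * A ∧
      (if 2 ≤ k then stepL x b m k m₁ k₁ L₀ L₁ (k - 1) else 0) = (1 - b * x) * B ∧
      stepR x b m k m₁ k₁ R₀ R₁ m = A + B ∧
      stepR x b m k m₁ k₁ R₀ R₁ (m + 1) = -(2 * (b * x) * A) - b * x * B ∧ (k = 1 → B = 0) := by
  -- The shape of the weights depends on the gap between this row and the next row of the upper
  -- partition.
  have hg : (k = 1 ∧ m₁ = 0) ∨ (2 ≤ k ∧ k = m₁ + 1) ∨ (k = m₁ + 2) ∨ (m₁ + 3 ≤ k) := by omega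
  have hd : m₁ = 0 ∨ 1 ≤ m₁ := by omega
  rcases hg with hg | hg | hg | hg
  · refine ⟨2 * (1 - 2 * (b * x)) * L₀, 0, ?_, ?_, ?_, ?_, fun _ => rfl⟩ <;>
    rcases h.cases with ⟨h1, rfl, rfl, rfl, rfl⟩ | ⟨h1, h2, rfl, rfl, rfl⟩ |
    ⟨h1, h2, rfl, rfl, rfl, rfl⟩ | ⟨h1, h2, rfl, rfl, rfl⟩ |
    ⟨h1, h2, A, B, rfl, rfl, rfl, rfl⟩ | ⟨h1, h2, rfl, rfl, rfl⟩ |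
    ⟨h1, h2, rfl, rfl⟩ | ⟨h1, h2, rfl, rfl, rfl⟩ <;> first | (exfalso; omega) | skip
    all_goals simp (disch := omega) only [stepL, stepR, if_pos, if_neg, wrow_of_not, wrow_far, wrow_far_self, wrow_near, wrow_near_self, wrow_near_fixed, wrow_near_fixed_self, wrow_touch, wrow_zero_self, wrow_false_zero, wrow_true_zero, wrow_false_one, wrow_true_one, wrow_false_one_self, wrow_true_one_self, arow_self_zero, arow_self, arow_grow, arow_grow_stacked, arow_of_not, pow_eq_self, pow_eq_one, lt_irrefl, false_and, if_false, true_and, or_true, true_or, if_true, and_true, or_false, false_or, le_refl, mul_zero, zero_mul, add_zero, zero_add, ite_self]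
    all_goals ring
  · rcases h.cases with ⟨h1, rfl, rfl, rfl, rfl⟩ | ⟨h1, h2, rfl, rfl, rfl⟩ |
      ⟨h1, h2, rfl, rfl, rfl, rfl⟩ | ⟨h1, h2, rfl, rfl, rfl⟩ |
      ⟨h1, h2, A, B, rfl, rfl, rfl, rfl⟩ | ⟨h1, h2, rfl, rfl, rfl⟩ |
      ⟨h1, h2, rfl, rfl⟩ | ⟨h1, h2, rfl, rfl, rfl⟩
    · omega
    · omega
    · omega
    · omega
    -- When both rows stay fixed at gap 1, the row weight is 1 and does not supply the factor `1 - 2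
    -- * (b * x)`. It comes from the invariant of the rows below, which is why `Balanced` records
    -- this factorisation. The second witness comes from the stacked pair of boxes, whose entry of
    -- `arow` is `2 * b`.
    · refine ⟨2 * A + 2 * (1 - b * x) * B, 2 * (b * x) * B, ?_, ?_, ?_, ?_, fun _ => by first | omega | rfl⟩ <;>
        simp (disch := omega) only [stepL, stepR, if_pos, if_neg, wrow_of_not, wrow_far, wrow_far_self, wrow_near, wrow_near_self, wrow_near_fixed, wrow_near_fixed_self, wrow_touch, wrow_zero_self, wrow_false_zero, wrow_true_zero, wrow_false_one, wrow_true_one, wrow_false_one_self, wrow_true_one_self, arow_self_zero, arow_self, arow_grow, arow_grow_stacked, arow_of_not, pow_eq_self, pow_eq_one, lt_irrefl, false_and, if_false, true_and, or_true, true_or, if_true, and_true, or_false, false_or, le_refl, mul_zero, zero_mul, add_zero, zero_add, ite_self] <;> ring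
    · refine ⟨2 * R₀, 0, ?_, ?_, ?_, ?_, fun _ => by first | omega | rfl⟩ <;>
        simp (disch := omega) only [stepL, stepR, if_pos, if_neg, wrow_of_not, wrow_far, wrow_far_self, wrow_near, wrow_near_self, wrow_near_fixed, wrow_near_fixed_self, wrow_touch, wrow_zero_self, wrow_false_zero, wrow_true_zero, wrow_false_one, wrow_true_one, wrow_false_one_self, wrow_true_one_self, arow_self_zero, arow_self, arow_grow, arow_grow_stacked, arow_of_not, pow_eq_self, pow_eq_one, lt_irrefl, false_and, if_false, true_and, or_true, true_or, if_true, and_true, or_false, false_or, le_refl, mul_zero, zero_mul, add_zero, zero_add, ite_self] <;> ring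
    · refine ⟨2 * (1 - b * x) * R₀, -(2 * (b * x) * R₀), ?_, ?_, ?_, ?_, fun _ => by first | omega | rfl⟩ <;>
        simp (disch := omega) only [stepL, stepR, if_pos, if_neg, wrow_of_not, wrow_far, wrow_far_self, wrow_near, wrow_near_self, wrow_near_fixed, wrow_near_fixed_self, wrow_touch, wrow_zero_self, wrow_false_zero, wrow_true_zero, wrow_false_one, wrow_true_one, wrow_false_one_self, wrow_true_one_self, arow_self_zero, arow_self, arow_grow, arow_grow_stacked, arow_of_not, pow_eq_self, pow_eq_one, lt_irrefl, false_and, if_false, true_and, or_true, true_or, if_true, and_true, or_false, false_or, le_refl, mul_zero, zero_mul, add_zero, zero_add, ite_self] <;> ring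
    · refine ⟨2 * (1 - b * x) * R₀, -(2 * (b * x) * R₀), ?_, ?_, ?_, ?_, fun _ => by first | omega | rfl⟩ <;>
        simp (disch := omega) only [stepL, stepR, if_pos, if_neg, wrow_of_not, wrow_far, wrow_far_self, wrow_near, wrow_near_self, wrow_near_fixed, wrow_near_fixed_self, wrow_touch, wrow_zero_self, wrow_false_zero, wrow_true_zero, wrow_false_one, wrow_true_one, wrow_false_one_self, wrow_true_one_self, arow_self_zero, arow_self, arow_grow, arow_grow_stacked, arow_of_not, pow_eq_self, pow_eq_one, lt_irrefl, false_and, if_false, true_and, or_true, true_or, if_true, and_true, or_false, false_or, le_refl, mul_zero, zero_mul, add_zero, zero_add, ite_self] <;> ring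
  · rcases h.cases with ⟨h1, rfl, rfl, rfl, rfl⟩ | ⟨h1, h2, rfl, rfl, rfl⟩ |
      ⟨h1, h2, rfl, rfl, rfl, rfl⟩ | ⟨h1, h2, rfl, rfl, rfl⟩ |
      ⟨h1, h2, A, B, rfl, rfl, rfl, rfl⟩ | ⟨h1, h2, rfl, rfl, rfl⟩ |
      ⟨h1, h2, rfl, rfl⟩ | ⟨h1, h2, rfl, rfl, rfl⟩
    · omega
    · refine ⟨2 * (1 - 2 * (b * x)) * L₁, 4 * (b * x) * L₁, ?_, ?_, ?_, ?_, fun _ => by first | omega | rfl⟩ <;>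
        simp (disch := omega) only [stepL, stepR, if_pos, if_neg, wrow_of_not, wrow_far, wrow_far_self, wrow_near, wrow_near_self, wrow_near_fixed, wrow_near_fixed_self, wrow_touch, wrow_zero_self, wrow_false_zero, wrow_true_zero, wrow_false_one, wrow_true_one, wrow_false_one_self, wrow_true_one_self, arow_self_zero, arow_self, arow_grow, arow_grow_stacked, arow_of_not, pow_eq_self, pow_eq_one, lt_irrefl, false_and, if_false, true_and, or_true, true_or, if_true, and_true, or_false, false_or, le_refl, mul_zero, zero_mul, add_zero, zero_add, ite_self] <;> ring
    · refine ⟨0, 0, ?_, ?_, ?_, ?_, fun _ => by first | omega | rfl⟩ <;>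
        simp (disch := omega) only [stepL, stepR, if_pos, if_neg, wrow_of_not, wrow_far, wrow_far_self, wrow_near, wrow_near_self, wrow_near_fixed, wrow_near_fixed_self, wrow_touch, wrow_zero_self, wrow_false_zero, wrow_true_zero, wrow_false_one, wrow_true_one, wrow_false_one_self, wrow_true_one_self, arow_self_zero, arow_self, arow_grow, arow_grow_stacked, arow_of_not, pow_eq_self, pow_eq_one, lt_irrefl, false_and, if_false, true_and, or_true, true_or, if_true, and_true, or_false, false_or, le_refl, mul_zero, zero_mul, add_zero, zero_add, ite_self] <;> ring
    · refine ⟨2 * (1 - 2 * (b * x)) * L₀, -(4 * (b * x) * (1 - 2 * (b * x)) * L₀), ?_, ?_, ?_, ?_, fun _ => by first | omega | rfl⟩ <;>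
        simp (disch := omega) only [stepL, stepR, if_pos, if_neg, wrow_of_not, wrow_far, wrow_far_self, wrow_near, wrow_near_self, wrow_near_fixed, wrow_near_fixed_self, wrow_touch, wrow_zero_self, wrow_false_zero, wrow_true_zero, wrow_false_one, wrow_true_one, wrow_false_one_self, wrow_true_one_self, arow_self_zero, arow_self, arow_grow, arow_grow_stacked, arow_of_not, pow_eq_self, pow_eq_one, lt_irrefl, false_and, if_false, true_and, or_true, true_or, if_true, and_true, or_false, false_or, le_refl, mul_zero, zero_mul, add_zero, zero_add, ite_self] <;> ring
    · refine ⟨2 * (1 - 2 * (b * x)) * ((1 - 2 * (b * x)) * A + (1 - b * x) * B), -(4 * (b * x) * (1 - 2 * (b * x)) * (A + B)), ?_, ?_, ?_, ?_, fun _ => by first | omega | rfl⟩ <;>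
        simp (disch := omega) only [stepL, stepR, if_pos, if_neg, wrow_of_not, wrow_far, wrow_far_self, wrow_near, wrow_near_self, wrow_near_fixed, wrow_near_fixed_self, wrow_touch, wrow_zero_self, wrow_false_zero, wrow_true_zero, wrow_false_one, wrow_true_one, wrow_false_one_self, wrow_true_one_self, arow_self_zero, arow_self, arow_grow, arow_grow_stacked, arow_of_not, pow_eq_self, pow_eq_one, lt_irrefl, false_and, if_false, true_and, or_true, true_or, if_true, and_true, or_false, false_or, le_refl, mul_zero, zero_mul, add_zero, zero_add, ite_self] <;> ring
    · refine ⟨2 * (1 - 2 * (b * x)) * (1 - 2 * (b * x)) * R₀, -(4 * (b * x) * (1 - 2 * (b * x)) * R₀), ?_, ?_, ?_, ?_, fun _ => by first | omega | rfl⟩ <;>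
        simp (disch := omega) only [stepL, stepR, if_pos, if_neg, wrow_of_not, wrow_far, wrow_far_self, wrow_near, wrow_near_self, wrow_near_fixed, wrow_near_fixed_self, wrow_touch, wrow_zero_self, wrow_false_zero, wrow_true_zero, wrow_false_one, wrow_true_one, wrow_false_one_self, wrow_true_one_self, arow_self_zero, arow_self, arow_grow, arow_grow_stacked, arow_of_not, pow_eq_self, pow_eq_one, lt_irrefl, false_and, if_false, true_and, or_true, true_or, if_true, and_true, or_false, false_or, le_refl, mul_zero, zero_mul, add_zero, zero_add, ite_self] <;> ring
    · refine ⟨2 * (1 - 2 * (b * x)) * (1 - b * x) * R₀, -(4 * (b * x) * (1 - 2 * (b * x)) * R₀), ?_, ?_, ?_, ?_, fun _ => by first | omega | rfl⟩ <;>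
        simp (disch := omega) only [stepL, stepR, if_pos, if_neg, wrow_of_not, wrow_far, wrow_far_self, wrow_near, wrow_near_self, wrow_near_fixed, wrow_near_fixed_self, wrow_touch, wrow_zero_self, wrow_false_zero, wrow_true_zero, wrow_false_one, wrow_true_one, wrow_false_one_self, wrow_true_one_self, arow_self_zero, arow_self, arow_grow, arow_grow_stacked, arow_of_not, pow_eq_self, pow_eq_one, lt_irrefl, false_and, if_false, true_and, or_true, true_or, if_true, and_true, or_false, false_or, le_refl, mul_zero, zero_mul, add_zero, zero_add, ite_self] <;> ring
    · refine ⟨2 * (1 - 2 * (b * x)) * (1 - b * x) * R₀, -(4 * (b * x) * (1 - 2 * (b * x)) * R₀), ?_, ?_, ?_, ?_, fun _ => by first | omega | rfl⟩ <;>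
        simp (disch := omega) only [stepL, stepR, if_pos, if_neg, wrow_of_not, wrow_far, wrow_far_self, wrow_near, wrow_near_self, wrow_near_fixed, wrow_near_fixed_self, wrow_touch, wrow_zero_self, wrow_false_zero, wrow_true_zero, wrow_false_one, wrow_true_one, wrow_false_one_self, wrow_true_one_self, arow_self_zero, arow_self, arow_grow, arow_grow_stacked, arow_of_not, pow_eq_self, pow_eq_one, lt_irrefl, false_and, if_false, true_and, or_true, true_or, if_true, and_true, or_false, false_or, le_refl, mul_zero, zero_mul, add_zero, zero_add, ite_self] <;> ring
  -- With a gap of at least 3 every row weight with a nonzero contribution is a far one, so the rows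
  -- below enter only through `L₀ + L₁`, which equals `R₀ + R₁`.
  · refine ⟨2 * (1 - 2 * (b * x)) * (L₀ + L₁), -(4 * (b * x) * (1 - 2 * (b * x)) * (L₀ + L₁)),
      ?_, ?_, ?_, ?_, fun _ => by omega⟩ <;>
    rcases h.cases with ⟨h1, rfl, rfl, rfl, rfl⟩ | ⟨h1, h2, rfl, rfl, rfl⟩ |
    ⟨h1, h2, rfl, rfl, rfl, rfl⟩ | ⟨h1, h2, rfl, rfl, rfl⟩ |
    ⟨h1, h2, A, B, rfl, rfl, rfl, rfl⟩ | ⟨h1, h2, rfl, rfl, rfl⟩ |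
    ⟨h1, h2, rfl, rfl⟩ | ⟨h1, h2, rfl, rfl, rfl⟩ <;> rcases hd with hd | hd <;> first | (exfalso; omega) | skip
    all_goals simp (disch := omega) only [stepL, stepR, if_pos, if_neg, wrow_of_not, wrow_far, wrow_far_self, wrow_near, wrow_near_self, wrow_near_fixed, wrow_near_fixed_self, wrow_touch, wrow_zero_self, wrow_false_zero, wrow_true_zero, wrow_false_one, wrow_true_one, wrow_false_one_self, wrow_true_one_self, arow_self_zero, arow_self, arow_grow, arow_grow_stacked, arow_of_not, pow_eq_self, pow_eq_one, lt_irrefl, false_and, if_false, true_and, or_true, true_or, if_true, and_true, or_false, false_or, le_refl, mul_zero, zero_mul, add_zero, zero_add, ite_self]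
    all_goals ring

/-- For `k > m + 1` even the extreme choices `k - 1` on the left and `m + 1` on the right would
require a row to shrink, so all four sums vanish. The remaining comparisons of `k` and `m` are the
three step lemmas, up to trivial cases of empty rows. -/
theorem Balanced.step (h : Balanced (b * x) m₁ k₁ L₀ L₁ R₀ R₁)
    (hm : m₁ < m ∨ (m = 0 ∧ m₁ = 0)) (hk : k₁ < k ∨ (k = 0 ∧ k₁ = 0)) :
    Balanced (b * x) m k (stepL x b m k m₁ k₁ L₀ L₁ k)
      (if 2 ≤ k then stepL x b m k m₁ k₁ L₀ L₁ (k - 1) else 0)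
      (stepR x b m k m₁ k₁ R₀ R₁ m) (if 1 ≤ m then stepR x b m k m₁ k₁ R₀ R₁ (m + 1) else 0) := by
  refine ⟨fun hk => if_neg (by omega), fun hm => if_neg (by omega), fun hkm => ?_, fun hkm => ?_,
    fun hkm h0 => ?_, fun hkm h0 => ?_, fun hkm => ?_⟩
  · simp (disch := omega) [stepL, stepR, wrow_of_not]
  · refine ⟨?_, ?_, ?_⟩
    · simp (disch := omega) [stepL, wrow_of_not]
    · simp (disch := omega) [stepR, wrow_of_not]
    · rcases Nat.eq_zero_or_pos m with h0 | h0
      · rw [if_neg (by omega), if_neg (by omega)]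
      · rw [if_pos (by omega), if_pos (by omega), h.step_grow hm hk hkm h0]
  · rw [if_neg (by omega), if_neg (by omega)]
    refine ⟨?_, rfl, rfl⟩
    have h1 : m₁ = 0 := by omega
    have h2 : k₁ = 0 := by omega
    rw [(h.2.2.2.2.1 (by omega) h2).1]
    simp (disch := omega) only [stepL, stepR, if_pos, if_neg, wrow_zero_self, arow_self_zero]
  · rw [if_pos (show 1 ≤ m by omega)]
    exact h.step_self hm hk hkm (by omega)
  · rw [if_pos (show 1 ≤ m by omega)]
    exact h.step_shrink hm hk hkm

end StrictPartition
-- The intertwining identity for one variable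
namespace StrictPartition
variable {R : Type*} [CommRing R]

/-- The change of basis preserves the number of parts. A part may therefore shrink by one only if it
is at least 2, and in `sum_range_eq_add_succ` it may grow by one only if it is at least 1. -/
theorem sum_range_eq_add_pred {N c : ℕ} (hc : c ≤ N) (g : ℕ → R)
    (hg : ∀ a, a ≠ c → ¬ (a + 1 = c ∧ 0 < a) → g a = 0) :
    ∑ a ∈ Finset.range (N + 1), g a = g c + if 2 ≤ c then g (c - 1) else 0 := by
  split_ifs with h
  · rw [← Finset.sum_pair (show c ≠ c - 1 by omega)]
    symm
    refine Finset.sum_subset ?_ fun a _ ha => ?_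
    · intro a ha
      simp only [Finset.mem_insert, Finset.mem_singleton, Finset.mem_range] at ha ⊢
      omega
    · simp only [Finset.mem_insert, Finset.mem_singleton] at ha
      exact hg a (by omega) (by omega)
  · rw [add_zero]
    refine Finset.sum_eq_single_of_mem c (by simpa [Nat.lt_succ_iff] using hc) fun a _ ha => ?_
    exact hg a ha (by omega)

theorem sum_range_eq_add_succ {N c : ℕ} (hc : c + 1 ≤ N) (g : ℕ → R)
    (hg : ∀ a, a ≠ c → ¬ (a = c + 1 ∧ 0 < c) → g a = 0) :
    ∑ a ∈ Finset.range (N + 1), g a = g c + if 1 ≤ c then g (c + 1) else 0 := by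
  split_ifs with h
  · rw [← Finset.sum_pair (show c ≠ c + 1 by omega)]
    symm
    refine Finset.sum_subset ?_ fun a _ ha => ?_
    · intro a ha
      simp only [Finset.mem_insert, Finset.mem_singleton, Finset.mem_range] at ha ⊢
      omega
    · simp only [Finset.mem_insert, Finset.mem_singleton] at ha
      exact hg a (by omega) (by omega)
  · rw [add_zero]
    refine Finset.sum_eq_single_of_mem c (by simp; omega) fun a _ ha => ?_
    exact hg a ha (by omega)

/-- The weights on the left hand side of the intertwining identity. -/
def weightL (x b : R) (μ κ : StrictPartition) (i a a' : ℕ) : R :=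
  wrow false x b (μ.parts i) a (μ.parts (i + 1)) a' * arow b a (κ.parts i) a' (κ.parts (i + 1))

/-- The weights on the right hand side of the intertwining identity. -/
def weightR (x b : R) (μ κ : StrictPartition) (i a a' : ℕ) : R :=
  arow b (μ.parts i) a (μ.parts (i + 1)) a' * wrow true x b a (κ.parts i) a' (κ.parts (i + 1))

variable (x b : R) {μ κ : StrictPartition} {N n : ℕ}

theorem chain_weightL_eq_zero (hκ : κ.parts n = 0) {k i a : ℕ} (hi : i + k = n)
    (ha : a ≠ κ.parts i) (ha' : ¬ (a + 1 = κ.parts i ∧ 0 < a)) :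
    chain N (weightL x b μ κ) k i a = 0 := by
  cases k with
  | zero =>
    rw [add_zero] at hi
    subst hi
    exact if_neg (by omega)
  | succ k =>
    refine Finset.sum_eq_zero fun a' _ => ?_
    rw [weightL, arow_of_not b (by omega), mul_zero, zero_mul, ite_self]

theorem chain_weightR_eq_zero (hμ : μ.parts n = 0) {k i a : ℕ} (hi : i + k = n)
    (ha : a ≠ μ.parts i) (ha' : ¬ (a = μ.parts i + 1 ∧ 0 < μ.parts i)) :
    chain N (weightR x b μ κ) k i a = 0 := by
  cases k with
  | zero =>
    rw [add_zero] at hi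
    subst hi
    exact if_neg (by omega)
  | succ k =>
    refine Finset.sum_eq_zero fun a' _ => ?_
    rw [weightR, arow_of_not b (by omega), zero_mul, zero_mul, ite_self]

/-- Induction from the bottom. At index `n` all rows are empty, and the invariant reads `L₀ = R₀ =
1`, `L₁ = R₁ = 0`. -/
theorem balanced_chain (hμ : μ.parts n = 0) (hκ : κ.parts n = 0) (hμN : μ.parts 0 + 1 ≤ N)
    (hκN : κ.parts 0 ≤ N) (k i : ℕ) (hi : i + k = n) :
    Balanced (b * x) (μ.parts i) (κ.parts i) (chain N (weightL x b μ κ) k i (κ.parts i))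
      (if 2 ≤ κ.parts i then chain N (weightL x b μ κ) k i (κ.parts i - 1) else 0)
      (chain N (weightR x b μ κ) k i (μ.parts i))
      (if 1 ≤ μ.parts i then chain N (weightR x b μ κ) k i (μ.parts i + 1) else 0) := by
  induction k generalizing i with
  | zero =>
    rw [add_zero] at hi
    subst hi
    simp [hμ, hκ, Balanced, chain]
  | succ k ih =>
    have key := (ih (i + 1) (by omega)).step (μ.descends i) (κ.descends i)
    have hL : ∀ a, chain N (weightL x b μ κ) (k + 1) i a =
        stepL x b (μ.parts i) (κ.parts i) (μ.parts (i + 1)) (κ.parts (i + 1))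
        (chain N (weightL x b μ κ) k (i + 1) (κ.parts (i + 1)))
        (if 2 ≤ κ.parts (i + 1) then
          chain N (weightL x b μ κ) k (i + 1) (κ.parts (i + 1) - 1) else 0) a := by
      intro a
      rw [chain, sum_range_eq_add_pred (c := κ.parts (i + 1))]
      · unfold stepL weightL
        congr 1
        by_cases h : 2 ≤ κ.parts (i + 1) ∧ κ.parts (i + 1) - 1 < a
        · rw [if_pos h.1, if_pos (show Descends _ _ from Or.inl h.2), if_pos h, if_pos h.1]
        · rw [if_neg h]
          split_ifs with h1 h2
          · have h3 : κ.parts (i + 1) - 1 < a ∨ (a = 0 ∧ κ.parts (i + 1) - 1 = 0) := h2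
            omega
          · rfl
          · rfl
      · exact (κ.parts_antitone (Nat.zero_le _)).trans hκN
      · intro c hc hc'
        rw [chain_weightL_eq_zero x b hκ (by omega) hc hc', mul_zero, ite_self]
    have hR : ∀ a, chain N (weightR x b μ κ) (k + 1) i a =
        stepR x b (μ.parts i) (κ.parts i) (μ.parts (i + 1)) (κ.parts (i + 1))
        (chain N (weightR x b μ κ) k (i + 1) (μ.parts (i + 1)))
        (if 1 ≤ μ.parts (i + 1) then
          chain N (weightR x b μ κ) k (i + 1) (μ.parts (i + 1) + 1) else 0) a := by
      intro a
      rw [chain, sum_range_eq_add_succ (c := μ.parts (i + 1))]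
      · unfold stepR weightR
        congr 1
        by_cases h : 1 ≤ μ.parts (i + 1) ∧ μ.parts (i + 1) + 1 < a
        · rw [if_pos h.1, if_pos (show Descends _ _ from Or.inl h.2), if_pos h, if_pos h.1]
        · rw [if_neg h]
          split_ifs with h1 h2
          · have h3 : μ.parts (i + 1) + 1 < a ∨ (a = 0 ∧ μ.parts (i + 1) + 1 = 0) := h2
            omega
          · rfl
          · rfl
      · exact (Nat.succ_le_succ (μ.parts_antitone (Nat.zero_le _))).trans hμN
      · intro c hc hc'
        rw [chain_weightR_eq_zero x b hμ (by omega) hc hc', mul_zero, ite_self]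
    rw [hL, hL, hR, hR]
    exact key

/-- The intertwining identity for the one-variable matrices. -/
theorem sum_prod_weightL_eq (hμN : μ.parts 0 + 1 ≤ N) (hκN : κ.parts 0 ≤ N) (hn : N ≤ n) :
    ∑ ν ∈ bounded N, ∏ j ∈ Finset.range n, weightL x b μ κ j (ν.parts j) (ν.parts (j + 1)) =
      ∑ ν ∈ bounded N,
        ∏ j ∈ Finset.range n, weightR x b μ κ j (ν.parts j) (ν.parts (j + 1)) := by
  have hμ : μ.parts n = 0 := parts_eq_zero_of_le μ (by omega)
  have hκ : κ.parts n = 0 := parts_eq_zero_of_le κ (by omega)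
  rw [sum_bounded_eq_chain N _ n hn, sum_bounded_eq_chain N _ n hn,
    sum_range_eq_add_pred hκN _ fun a => chain_weightL_eq_zero x b hκ (zero_add n),
    sum_range_eq_add_succ hμN _ fun a => chain_weightR_eq_zero x b hμ (zero_add n)]
  exact (balanced_chain x b hμ hκ hμN hκN n 0 (zero_add n)).add_eq_add

end StrictPartition
-- Factorisation of the one-variable matrix over rows
namespace StrictPartition
variable {R : Type*} [CommRing R]
variable (x b : R) {μ ν : StrictPartition} {N n : ℕ}

theorem hrow_of_not {m k m₁ : ℕ} (h : m < k ∨ (k ≤ m₁ ∧ 0 < m₁)) : hrow x b m k m₁ = 0 :=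
  if_neg (by omega)

theorem vrow_of_not {f : Bool} {m k n₁ : ℕ} (h : m ≠ k) (h' : m ≠ k + 1) :
    vrow f x b m k n₁ = 0 :=
  if_neg (by omega)

theorem sum_hrow_mul_vrow {f : Bool} (m k m₁ k₁ : ℕ) (hm : m ≤ N) :
    ∑ a ∈ Finset.range (N + 1), hrow x b m a m₁ * vrow f x b a k k₁ = wrow f x b m k m₁ k₁ := by
  rw [wrow, ← Finset.sum_pair (f := fun a => hrow x b m a m₁ * vrow f x b a k k₁)
    (show k ≠ k + 1 by omega)]
  -- The values `k` and `k + 1` may exceed `N`, so both index sets are compared with their union: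
  -- outside `{k, k + 1}` the primed weight vanishes, beyond `N` the unprimed one does.
  rw [Finset.sum_subset (s₂ := Finset.range (N + 1) ∪ {k, k + 1}) Finset.subset_union_left,
    Finset.sum_subset (s₁ := {k, k + 1}) (s₂ := Finset.range (N + 1) ∪ {k, k + 1})
      Finset.subset_union_right]
  · intro a _ ha
    simp only [Finset.mem_insert, Finset.mem_singleton, not_or] at ha
    rw [vrow_of_not x b ha.1 ha.2, mul_zero]
  · intro a _ ha
    simp only [Finset.mem_range] at ha
    rw [hrow_of_not x b (by omega), zero_mul]

/-- The weights involve the intermediate partition only through its own row `a`, so its rows can be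
summed independently once strictness is dropped. Dropping it is harmless: if `a'` follows `a`
without descending, either `a'` exceeds the row of `μ` and the rest vanishes (the first conjunct,
carried along for this purpose), or the horizontal strip condition in `hrow` fails. -/
theorem sum_chain_hrow_mul_vrow (f : Bool) (hμ : μ.parts n = 0) (hμN : μ.parts 0 ≤ N) (k i : ℕ)
    (hi : i + k = n) :
    (∀ a, μ.parts i < a → chain N (fun j a _ => hrow x b (μ.parts j) a (μ.parts (j + 1)) *
      vrow f x b a (ν.parts j) (ν.parts (j + 1))) k i a = 0) ∧
    ∑ a ∈ Finset.range (N + 1), chain N (fun j a _ => hrow x b (μ.parts j) a (μ.parts (j + 1)) *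
      vrow f x b a (ν.parts j) (ν.parts (j + 1))) k i a =
    ∏ j ∈ Finset.range k, wrow f x b (μ.parts (i + j)) (ν.parts (i + j)) (μ.parts (i + j + 1))
      (ν.parts (i + j + 1)) := by
  induction k generalizing i with
  | zero =>
    rw [add_zero] at hi
    subst hi
    refine ⟨fun a ha => if_neg (by omega), ?_⟩
    simp [chain]
  | succ k ih =>
    obtain ⟨ih1, ih2⟩ := ih (i + 1) (by omega)
    refine ⟨fun a ha => Finset.sum_eq_zero fun a' _ => ?_, ?_⟩
    · simp [hrow_of_not x b (Or.inl ha)]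
    · rw [Finset.prod_range_succ', mul_comm]
      rw [Finset.prod_congr rfl fun j _ => by rw [show i + (j + 1) = i + 1 + j by omega], ← ih2,
        add_zero, ← sum_hrow_mul_vrow x b (f := f) (N := N) _ _ _ _
        ((μ.parts_antitone (Nat.zero_le i)).trans hμN), Finset.sum_mul_sum]
      refine Finset.sum_congr rfl fun a _ => Finset.sum_congr rfl fun a' _ => ?_
      split_ifs with h
      · rfl
      · by_cases h1 : μ.parts (i + 1) < a'
        · rw [ih1 a' h1, mul_zero]
        · have h2 : ¬ (a' < a ∨ (a = 0 ∧ a' = 0)) := h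
          rw [hrow_of_not x b (by omega), zero_mul, zero_mul]

/-- The one-variable matrix is the product of the two one-letter matrices. -/
theorem sum_prod_hrow_mul_prod_vrow (f : Bool) (ν : StrictPartition) (hμN : μ.parts 0 ≤ N)
    (hn : N ≤ n) :
    ∑ η ∈ bounded N,
      (∏ j ∈ Finset.range n, hrow x b (μ.parts j) (η.parts j) (μ.parts (j + 1))) *
        ∏ j ∈ Finset.range n, vrow f x b (η.parts j) (ν.parts j) (ν.parts (j + 1)) =
      ∏ j ∈ Finset.range n, wrow f x b (μ.parts j) (ν.parts j) (μ.parts (j + 1))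
        (ν.parts (j + 1)) := by
  have h := (sum_chain_hrow_mul_vrow x b (ν := ν) f (parts_eq_zero_of_le μ (hμN.trans hn)) hμN n 0
    (zero_add n)).2
  simp only [zero_add] at h
  rw [← h, ← sum_bounded_eq_chain N (fun j a _ => hrow x b (μ.parts j) a (μ.parts (j + 1)) *
      vrow f x b a (ν.parts j) (ν.parts (j + 1))) n hn]
  simp only [Finset.prod_mul_distrib]

end StrictPartition
-- The inverse of the change of basis
namespace StrictPartition
variable {R : Type*} [CommRing R]

/-- The contribution of a row to the entries of the inverse change of basis matrix: the row grows
from length `k` to length `n`, and the next row has length `n₁` after it has grown. The element `h`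
is an inverse of `2`. -/
def brow (b h : R) (k n n₁ : ℕ) : R :=
  if k ≤ n ∧ (k = 0 ↔ n = 0) then
    b ^ (n - k) * (if 0 < k then h * 2 ^ (n₁ + 1 - k) else 1)
  else 0

variable {b h : R}

theorem brow_of_not {k n n₁ : ℕ} (hk : n < k ∨ (k = 0 ∧ 0 < n)) : brow b h k n n₁ = 0 :=
  if_neg (by omega)

theorem brow_pos {k n n₁ : ℕ} (hk : 0 < k) (hn : k ≤ n) :
    brow b h k n n₁ = b ^ (n - k) * (h * 2 ^ (n₁ + 1 - k)) := by
  simp (disch := omega) only [brow, if_pos]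

theorem brow_zero {n₁ : ℕ} : brow b h 0 0 n₁ = 1 := by simp [brow]

/-- The weights of the product of the change of basis matrix and its inverse. -/
def weightInv (b h : R) (ν ρ : StrictPartition) (i a a' : ℕ) : R :=
  arow b (ν.parts i) a (ν.parts (i + 1)) a' * brow b h a (ρ.parts i) (ρ.parts (i + 1))

variable {ν ρ : StrictPartition} {N n : ℕ}

theorem chain_weightInv_eq_zero (hν : ν.parts n = 0) {k i a : ℕ} (hi : i + k = n)
    (ha : a ≠ ν.parts i) (ha' : ¬ (a = ν.parts i + 1 ∧ 0 < ν.parts i)) :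
    chain N (weightInv b h ν ρ) k i a = 0 := by
  cases k with
  | zero =>
    rw [add_zero] at hi
    subst hi
    exact if_neg (by omega)
  | succ k =>
    refine Finset.sum_eq_zero fun a' _ => ?_
    rw [weightInv, arow_of_not b (by omega), zero_mul, zero_mul, ite_self]

/-- The relation between the partial sums of the product of the change of basis matrix and its
inverse, where the first of the remaining rows has length `m` in the smaller and `p` in the larger
partition, and `e` says whether the remaining rows are the same. -/
def Cancels (m p : ℕ) (e : Prop) (S₀ S₁ : R) : Prop :=
  (m = 0 → S₁ = 0) ∧ (p < m → S₀ = 0 ∧ S₁ = 0) ∧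
    (p = m → S₁ = 0 ∧ (e → S₀ = 1) ∧ (¬ e → S₀ = 0)) ∧ (m < p → S₁ = -S₀)

/-- One step of the transfer recursion, where the new row has length `a`. -/
def stepInv (b h : R) (m p m₁ p₁ : ℕ) (S₀ S₁ : R) (a : ℕ) : R :=
  (if m₁ < a ∨ (a = 0 ∧ m₁ = 0) then arow b m a m₁ m₁ * brow b h a p p₁ * S₀ else 0) +
  (if 1 ≤ m₁ ∧ m₁ + 1 < a then arow b m a m₁ (m₁ + 1) * brow b h a p p₁ * S₁ else 0)

/-- If `m < p`, lengthening the row replaces one `b` of `brow` by the `-b` of `arow`, and the two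
terms cancel. In the tight case `m = m₁ + 1 ≤ p₁` the lengthened row also loses one factor 2 of
overlap, but there the stacked term with opposite sign joins in, and since `S₁ = -S₀` it doubles the
contribution. If the gap is larger, `S₀` and `S₁` have equal weights and already cancel below. -/
theorem Cancels.step {m p m₁ p₁ : ℕ} {e : Prop} {S₀ S₁ : R} (hc : Cancels m₁ p₁ e S₀ S₁)
    (hh : 2 * h = 1) (hm : m₁ < m ∨ (m = 0 ∧ m₁ = 0)) (hp : p₁ < p ∨ (p = 0 ∧ p₁ = 0)) :
    Cancels m p (p = m ∧ p₁ = m₁ ∧ e) (stepInv b h m p m₁ p₁ S₀ S₁ m)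
      (if 1 ≤ m then stepInv b h m p m₁ p₁ S₀ S₁ (m + 1) else 0) := by
  obtain ⟨h0, h1, h2, h3⟩ := hc
  refine ⟨fun _ => if_neg (by omega), fun hpm => ?_, fun hpm => ?_, fun hpm => ?_⟩
  · simp (disch := omega) [stepInv, brow_of_not]
  · refine ⟨?_, ?_⟩
    · simp (disch := omega) [stepInv, brow_of_not]
    · have key : stepInv b h m p m₁ p₁ S₀ S₁ m = S₀ + S₁ := by
        rcases Nat.eq_zero_or_pos m with hm0 | hm0
        · have : m₁ = 0 := by omega
          have : p = 0 := by omega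
          subst hm0 this
          rw [h0 (by omega)]
          simp (disch := omega) only [stepInv, if_pos, if_neg, arow_self_zero, brow_zero, true_and]
          ring
        · simp (disch := omega) only [stepInv, if_pos, arow_self, brow_pos, pow_eq_one]
          rw [show 2 * (1 * (h * 1)) = (2 * h : R) by ring, hh]
          split_ifs with hs
          · ring
          · rcases lt_trichotomy p₁ m₁ with hlt | heq | hgt
            · rw [(h1 hlt).2]; ring
            · rw [(h2 heq).1]; ring
            · rw [h0 (by omega)]; ring
      rw [key]
      rcases lt_trichotomy p₁ m₁ with hlt | heq | hgt
      · obtain ⟨h4, h5⟩ := h1 hlt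
        exact ⟨fun he => by omega, fun _ => by rw [h4, h5, add_zero]⟩
      · obtain ⟨h4, h5, h6⟩ := h2 heq
        rw [h4, add_zero]
        exact ⟨fun he => h5 he.2.2, fun he => h6 fun h => he ⟨hpm, heq, h⟩⟩
      · rw [h3 hgt, add_neg_cancel]
        exact ⟨fun he => by omega, fun _ => rfl⟩
  · rcases Nat.eq_zero_or_pos m with hm0 | hm0
    · simp (disch := omega) [stepInv, brow_of_not, if_neg]
    · rw [if_pos (show 1 ≤ m from hm0)]
      have e1 : b ^ (p - m) = b ^ (p - (m + 1)) * b := by rw [← pow_succ]; congr 1; omega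
      rcases lt_trichotomy p₁ m₁ with hlt | heq | hgt
      · obtain ⟨h4, h5⟩ := h1 hlt
        simp [stepInv, h4, h5]
      · obtain ⟨h4, h5⟩ := h2 heq
        simp (disch := omega) only [stepInv, if_pos, arow_self, brow_pos, pow_eq_one, h4,
          arow_grow, mul_zero, ite_self, e1]
        ring
      · rw [h3 hgt]
        rcases Nat.eq_zero_or_pos m₁ with hm1 | hm1
        · have hS := h0 hm1
          rw [h3 hgt, neg_eq_zero] at hS
          simp [stepInv, hS]
        · by_cases hs : m = m₁ + 1
          · have e2 : (2 : R) ^ (p₁ + 1 - m) = 2 ^ (p₁ + 1 - (m + 1)) * 2 := by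
              rw [← pow_succ]; congr 1; omega
            simp (disch := omega) only [stepInv, if_pos, if_neg, arow_self, brow_pos,
              arow_grow, arow_grow_stacked, e1, e2]
            ring
          · simp (disch := omega) only [stepInv, if_pos, arow_self, brow_pos, arow_grow]
            ring

theorem cancels_chain (hh : 2 * h = 1) (hν : ν.parts n = 0) (hρ : ρ.parts n = 0)
    (hνN : ν.parts 0 + 1 ≤ N) (k i : ℕ) (hi : i + k = n) :
    Cancels (ν.parts i) (ρ.parts i) (∀ j, i ≤ j → ρ.parts j = ν.parts j)
      (chain N (weightInv b h ν ρ) k i (ν.parts i))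
      (if 1 ≤ ν.parts i then chain N (weightInv b h ν ρ) k i (ν.parts i + 1) else 0) := by
  induction k generalizing i with
  | zero =>
    rw [add_zero] at hi
    subst hi
    refine ⟨fun _ => if_neg (by omega), fun _ => by omega, fun _ => ⟨if_neg (by omega),
      fun _ => if_pos hν, fun he => (he fun j hj => ?_).elim⟩, fun _ => by omega⟩
    have h1 := ν.parts_antitone hj
    have h2 := ρ.parts_antitone hj
    omega
  | succ k ih =>
    have key := (ih (i + 1) (by omega)).step (b := b) hh (ν.descends i) (ρ.descends i)
    have hS : ∀ a, chain N (weightInv b h ν ρ) (k + 1) i a =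
        stepInv b h (ν.parts i) (ρ.parts i) (ν.parts (i + 1)) (ρ.parts (i + 1))
        (chain N (weightInv b h ν ρ) k (i + 1) (ν.parts (i + 1)))
        (if 1 ≤ ν.parts (i + 1) then
          chain N (weightInv b h ν ρ) k (i + 1) (ν.parts (i + 1) + 1) else 0) a := by
      intro a
      rw [chain, sum_range_eq_add_succ (c := ν.parts (i + 1))]
      · unfold stepInv weightInv
        congr 1
        by_cases h : 1 ≤ ν.parts (i + 1) ∧ ν.parts (i + 1) + 1 < a
        · rw [if_pos h.1, if_pos (show Descends _ _ from Or.inl h.2), if_pos h, if_pos h.1]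
        · rw [if_neg h]
          split_ifs with h1 h2
          · have h3 : ν.parts (i + 1) + 1 < a ∨ (a = 0 ∧ ν.parts (i + 1) + 1 = 0) := h2
            omega
          · rfl
          · rfl
      · exact (Nat.succ_le_succ (ν.parts_antitone (Nat.zero_le _))).trans hνN
      · intro c hc hc'
        rw [chain_weightInv_eq_zero hν (by omega) hc hc', mul_zero, ite_self]
    rw [hS, hS]
    convert key using 2
    constructor
    · exact fun h => ⟨h i le_rfl, h (i + 1) (by omega), fun j hj => h j (by omega)⟩
    · rintro ⟨h1, h2, h3⟩ j hj
      rcases hj.eq_or_lt with rfl | hj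
      · exact h1
      · exact h3 j hj

/-- The two change of basis matrices are inverse to each other. -/
theorem sum_prod_weightInv (hh : 2 * h = 1) (hνN : ν.parts 0 + 1 ≤ N) (hρN : ρ.parts 0 ≤ N)
    (hn : N ≤ n) [Decidable (ν = ρ)] :
    ∑ κ ∈ bounded N, ∏ j ∈ Finset.range n, weightInv b h ν ρ j (κ.parts j) (κ.parts (j + 1)) =
      if ν = ρ then 1 else 0 := by
  have hν : ν.parts n = 0 := parts_eq_zero_of_le ν (by omega)
  have hρ : ρ.parts n = 0 := parts_eq_zero_of_le ρ (by omega)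
  rw [sum_bounded_eq_chain N _ n hn,
    sum_range_eq_add_succ hνN _ fun a => chain_weightInv_eq_zero hν (zero_add n)]
  obtain ⟨-, h1, h2, h3⟩ := cancels_chain (b := b) hh hν hρ hνN n 0 (zero_add n)
  rcases lt_trichotomy (ρ.parts 0) (ν.parts 0) with hlt | heq | hgt
  · rw [(h1 hlt).1, (h1 hlt).2, add_zero, if_neg (by rintro rfl; omega)]
  · obtain ⟨h4, h5, h6⟩ := h2 heq
    rw [h4, add_zero]
    split_ifs with he
    · exact h5 fun j _ => by rw [he]
    · exact h6 fun hj => he (StrictPartition.ext (funext fun j => (hj j (Nat.zero_le j)).symm))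
  · rw [h3 hgt, add_neg_cancel, if_neg (by rintro rfl; omega)]

end StrictPartition
-- Row products in terms of length, size, columns and overlap
namespace StrictPartition
variable {R : Type*} [CommRing R]

theorem card_eq_sum_rows (D : Finset (ℕ × ℕ)) (lo hi : ℕ → ℕ) (n : ℕ)
    (hD : ∀ i j, (i, j) ∈ D ↔ i < n ∧ lo i ≤ j ∧ j < hi i) :
    D.card = ∑ i ∈ Finset.range n, (hi i - lo i) := by
  rw [Finset.card_eq_sum_card_fiberwise (f := Prod.fst) (t := Finset.range n)]
  · refine Finset.sum_congr rfl fun i hi' => ?_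
    have : D.filter (fun p => p.1 = i) = (Finset.Ico (lo i) (hi i)).image (Prod.mk i) := by
      ext ⟨i', j⟩
      simp only [Finset.mem_filter, hD, Finset.mem_image, Finset.mem_Ico, Prod.mk.injEq]
      rw [Finset.mem_range] at hi'
      constructor
      · rintro ⟨h, rfl⟩
        exact ⟨j, h.2, rfl, rfl⟩
      · rintro ⟨j', h, rfl, rfl⟩
        exact ⟨⟨hi', h⟩, rfl⟩
    rw [this, Finset.card_image_of_injective _ (Prod.mk_right_injective i), Nat.card_Ico]
  · rintro ⟨i, j⟩ hp
    exact Finset.mem_coe.2 (Finset.mem_range.2 ((hD i j).1 hp).1)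

theorem mem_skewSD {κ ν : StrictPartition} {i j : ℕ} :
    (i, j) ∈ skewSD κ ν ↔ i + ν.parts i ≤ j ∧ j < i + κ.parts i := by
  rw [skewSD, Finset.mem_sdiff, mem_SD, mem_SD]
  omega

theorem lt_of_parts_pos {κ : StrictPartition} {i n : ℕ} (hn : κ.parts 0 ≤ n)
    (hi : 0 < κ.parts i) : i < n := by
  have := κ.parts_add_le i hi
  omega

theorem skewSize_eq_sum {κ ν : StrictPartition} {n : ℕ} (hn : κ.parts 0 ≤ n) :
    skewSize κ ν = ∑ i ∈ Finset.range n, (κ.parts i - ν.parts i) := by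
  rw [skewSize, card_eq_sum_rows _ (fun i => i + ν.parts i) (fun i => i + κ.parts i) n]
  · exact Finset.sum_congr rfl fun i _ => by omega
  · intro i j
    rw [mem_skewSD]
    refine ⟨fun h => ⟨lt_of_parts_pos hn (by omega), h⟩, fun h => h.2⟩

theorem len_eq_card {κ : StrictPartition} {n : ℕ} (hn : κ.parts 0 ≤ n) :
    κ.len = ((Finset.range n).filter fun i => 0 < κ.parts i).card := by
  rw [len, ← Set.ncard_coe_finset]
  congr 1
  ext i
  simp only [Set.mem_setOf_eq, Finset.coe_filter, Finset.mem_range]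
  exact ⟨fun h => ⟨lt_of_parts_pos hn h, h⟩, fun h => h.2⟩

theorem pow_len {κ : StrictPartition} {n : ℕ} (hn : κ.parts 0 ≤ n) (c : R) :
    c ^ κ.len = ∏ i ∈ Finset.range n, if 0 < κ.parts i then c else 1 := by
  rw [len_eq_card hn, Finset.prod_ite, Finset.prod_const, Finset.prod_const_one, mul_one]

theorem len_le_len {κ ν : StrictPartition} (h : κ ≤ ν) : κ.len ≤ ν.len := by
  rw [len_eq_card (κ := ν) (le_refl _), len_eq_card (κ := κ) (h 0)]
  refine Finset.card_le_card fun i hi => ?_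
  rw [Finset.mem_filter] at hi ⊢
  exact ⟨hi.1, hi.2.trans_le (h i)⟩

theorem len_eq_len_iff {κ ν : StrictPartition} (h : κ ≤ ν) :
    κ.len = ν.len ↔ ∀ i, κ.parts i = 0 ↔ ν.parts i = 0 := by
  rw [len_eq_card (κ := ν) (le_refl _), len_eq_card (κ := κ) (h 0)]
  have hsub : (Finset.range (ν.parts 0)).filter (fun i => 0 < κ.parts i) ⊆
      (Finset.range (ν.parts 0)).filter (fun i => 0 < ν.parts i) := by
    intro i hi
    rw [Finset.mem_filter] at hi ⊢
    exact ⟨hi.1, hi.2.trans_le (h i)⟩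
  constructor
  · intro hc i
    have he := Finset.eq_of_subset_of_card_le hsub hc.ge
    refine ⟨fun h0 => ?_, fun h0 => Nat.le_zero.1 (h0 ▸ h i)⟩
    by_contra hne
    have hmem : i ∈ (Finset.range (ν.parts 0)).filter (fun i => 0 < ν.parts i) := by
      rw [Finset.mem_filter, Finset.mem_range]
      exact ⟨lt_of_parts_pos le_rfl (Nat.pos_of_ne_zero hne), Nat.pos_of_ne_zero hne⟩
    rw [← he, Finset.mem_filter] at hmem
    omega
  · intro hz
    congr 1
    refine Finset.filter_congr fun i _ => ?_
    have := hz i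
    omega

theorem isVerticalStrip_iff {κ ν : StrictPartition} :
    IsVerticalStrip κ ν ↔ ∀ i, κ.parts i ≤ ν.parts i + 1 := by
  constructor
  · intro h i
    by_contra hlt
    have := h i (i + ν.parts i) (i + ν.parts i + 1) (by rw [mem_skewSD]; omega)
      (by rw [mem_skewSD]; omega)
    omega
  · intro h i j j' hj hj'
    rw [mem_skewSD] at hj hj'
    have := h i
    omega

theorem add_parts_antitone (κ : StrictPartition) {i i' : ℕ} (h : i ≤ i') (hi : 0 < κ.parts i') :
    i' + κ.parts i' ≤ i + κ.parts i := by
  induction i', h using Nat.le_induction with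
  | base => rfl
  | succ k hk ih =>
    have h1 := κ.descends k
    unfold Descends at h1
    have := ih (by omega)
    omega

/-- Each column is counted by its lowest box. In a vertical strip the box of row `i` lies in column
`i + ν.parts i`, and if a lower row has its box in the same column, then so does row `i + 1`,
because `ν` is strict. -/
theorem cols_eq_card {κ ν : StrictPartition} {n : ℕ} (hn : κ.parts 0 ≤ n)
    (hz : ∀ i, ν.parts i = 0 ↔ κ.parts i = 0) (hv : ∀ i, κ.parts i ≤ ν.parts i + 1) :
    cols κ ν = ((Finset.range n).filter fun i => κ.parts i = ν.parts i + 1 ∧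
      ¬ (κ.parts (i + 1) = ν.parts (i + 1) + 1 ∧ ν.parts i = ν.parts (i + 1) + 1)).card := by
  have hinj : Set.InjOn (fun i => i + ν.parts i) ((Finset.range n).filter fun i =>
      κ.parts i = ν.parts i + 1 ∧
      ¬ (κ.parts (i + 1) = ν.parts (i + 1) + 1 ∧ ν.parts i = ν.parts (i + 1) + 1)) := by
    have main : ∀ i i', i < i' → κ.parts i' = ν.parts i' + 1 → κ.parts i = ν.parts i + 1 →
        i + ν.parts i = i' + ν.parts i' →
        (κ.parts (i + 1) = ν.parts (i + 1) + 1 ∧ ν.parts i = ν.parts (i + 1) + 1) := by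
      intro i i' hlt h1 h2 h3
      have h4 := hz i'
      have h5 := ν.add_parts_antitone (i := i + 1) (i' := i') hlt (by omega)
      have h6 := κ.add_parts_antitone (i := i + 1) (i' := i') hlt (by omega)
      have h7 := ν.descends i
      unfold Descends at h7
      have h8 := hv (i + 1)
      have h9 := hz (i + 1)
      omega
    intro i hi i' hi' h
    simp only [Finset.coe_filter, Set.mem_setOf_eq] at hi hi' h
    rcases lt_trichotomy i i' with hlt | heq | hgt
    · exact absurd (main i i' hlt hi'.2.1 hi.2.1 h) hi.2.2
    · exact heq
    · exact absurd (main i' i hgt hi.2.1 hi'.2.1 h.symm) hi'.2.2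
  rw [cols, ← Finset.card_image_of_injOn hinj]
  congr 1
  ext c
  simp only [Finset.mem_image, Prod.exists, exists_eq_right, Finset.mem_filter, Finset.mem_range]
  constructor
  · rintro ⟨i, hi⟩
    -- Walking down the column reaches its lowest box; `k` bounds the number of rows still ahead.
    have main : ∀ k i, n ≤ i + k → (i, c) ∈ skewSD κ ν → ∃ a, (a < n ∧
        κ.parts a = ν.parts a + 1 ∧
        ¬ (κ.parts (a + 1) = ν.parts (a + 1) + 1 ∧ ν.parts a = ν.parts (a + 1) + 1)) ∧
        a + ν.parts a = c := by
      intro k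
      induction k with
      | zero =>
        intro i hi hc
        rw [mem_skewSD] at hc
        have := lt_of_parts_pos (i := i) hn (by omega)
        omega
      | succ k ih =>
        intro i hi hc
        by_cases hs : (i + 1, c) ∈ skewSD κ ν
        · exact ih (i + 1) (by omega) hs
        · rw [mem_skewSD] at hc hs
          have := hv i
          exact ⟨i, ⟨lt_of_parts_pos (i := i) hn (by omega), by omega, by omega⟩, by omega⟩
    exact main n i (by omega) hi
  · rintro ⟨i, ⟨h1, h2, h3⟩, h4⟩
    exact ⟨i, by rw [mem_skewSD]; omega⟩

/-- The boxes of row `i + 1` with a neighbour above occupy the columns from `i + κ.parts i` to `i +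
ν.parts (i + 1)`: strictness of `κ` makes row `i + 1` of the skew shape start early enough, and
strictness of `ν` makes row `i` extend far enough. -/
theorem overlap_eq_sum {ν κ : StrictPartition} {n : ℕ} (hn : ν.parts 0 ≤ n)
    (hz : ∀ i, κ.parts i = 0 ↔ ν.parts i = 0) :
    overlap ν κ = ∑ i ∈ Finset.range n,
      if 0 < κ.parts i then ν.parts (i + 1) + 1 - κ.parts i else 0 := by
  rw [overlap, card_eq_sum_rows _ (fun i => i - 1 + κ.parts (i - 1))
    (fun i => if 0 < i ∧ 0 < κ.parts (i - 1) then i + ν.parts i else 0) (n + 1)]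
  · rw [Finset.sum_range_succ']
    simp only [Nat.add_sub_cancel, lt_irrefl, false_and, if_false, Nat.zero_sub, add_zero]
    refine Finset.sum_congr rfl fun i _ => ?_
    split_ifs <;> omega
  · intro i j
    rw [Finset.mem_filter, mem_skewSD, mem_skewSD]
    cases i with
    | zero => simp
    | succ i =>
      have h1 := hz i
      have h2 := hz (i + 1)
      have h3 := κ.descends i
      have h4 := ν.descends i
      have h5 : 0 < ν.parts i → i < n := fun h => lt_of_parts_pos hn h
      unfold Descends at h3 h4
      simp only [Nat.add_sub_cancel]
      split_ifs <;> omega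

/-- The entries of the change of basis matrix in terms of statistics of skew shapes. -/
theorem prod_arow {b : R} {ν κ : StrictPartition} {n : ℕ} (hn : κ.parts 0 ≤ n)
    (hle : ν ≤ κ) (hlen : ν.len = κ.len) (hv : IsVerticalStrip κ ν) :
    ∏ j ∈ Finset.range n, arow b (ν.parts j) (κ.parts j) (ν.parts (j + 1)) (κ.parts (j + 1)) =
      2 ^ ν.len * ((-1) ^ cols κ ν * b ^ skewSize κ ν) := by
  rw [len_eq_len_iff hle] at hlen
  rw [isVerticalStrip_iff] at hv
  rw [pow_len ((hle 0).trans hn), cols_eq_card hn hlen hv, skewSize_eq_sum hn,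
    ← Finset.prod_pow_eq_pow_sum, ← Finset.prod_const, Finset.prod_filter,
    ← Finset.prod_mul_distrib, ← Finset.prod_mul_distrib]
  refine Finset.prod_congr rfl fun i _ => ?_
  rw [arow, if_pos ⟨hle i, hv i, hlen i⟩]
  congr 1
  by_cases h : κ.parts i = ν.parts i + 1
  · simp only [h, true_and, if_true, Nat.add_sub_cancel_left, pow_one]
    split_ifs <;> first | tauto | simp
  · have : κ.parts i = ν.parts i := by have := hv i; have := hle i; omega
    simp [this]

theorem prod_arow_eq_zero {b : R} {ν κ : StrictPartition} {n : ℕ} (hν : ν.parts 0 ≤ n)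
    (hn : κ.parts 0 ≤ n) (h : ¬ (ν ≤ κ ∧ ν.len = κ.len ∧ IsVerticalStrip κ ν)) :
    ∏ j ∈ Finset.range n,
      arow b (ν.parts j) (κ.parts j) (ν.parts (j + 1)) (κ.parts (j + 1)) = 0 := by
  by_contra h0
  have h1 : ∀ i, ν.parts i ≤ κ.parts i ∧ κ.parts i ≤ ν.parts i + 1 ∧
      (ν.parts i = 0 ↔ κ.parts i = 0) := by
    intro i
    by_cases hi : i < n
    · by_contra hc
      exact h0 (Finset.prod_eq_zero (Finset.mem_range.2 hi) (if_neg hc))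
    · rw [parts_eq_zero_of_le ν (by omega), parts_eq_zero_of_le κ (by omega)]
      simp
  have hle : ν ≤ κ := fun i => (h1 i).1
  exact h ⟨hle, (len_eq_len_iff hle).2 fun i => (h1 i).2.2,
    isVerticalStrip_iff.2 fun i => (h1 i).2.1⟩

theorem prod_brow {b h : R} {ν κ : StrictPartition} {n : ℕ} (hn : ν.parts 0 ≤ n)
    (hle : κ ≤ ν) (hlen : κ.len = ν.len) :
    ∏ j ∈ Finset.range n, brow b h (κ.parts j) (ν.parts j) (ν.parts (j + 1)) =
      h ^ ν.len * (2 ^ overlap ν κ * b ^ skewSize ν κ) := by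
  rw [← hlen]
  rw [len_eq_len_iff hle] at hlen
  rw [pow_len ((hle 0).trans hn), overlap_eq_sum hn hlen, skewSize_eq_sum hn,
    ← Finset.prod_pow_eq_pow_sum, ← Finset.prod_pow_eq_pow_sum,
    ← Finset.prod_mul_distrib, ← Finset.prod_mul_distrib]
  refine Finset.prod_congr rfl fun i _ => ?_
  rw [brow, if_pos ⟨hle i, hlen i⟩]
  split_ifs <;> ring

theorem prod_brow_eq_zero {b h : R} {ν κ : StrictPartition} {n : ℕ} (hκ : κ.parts 0 ≤ n)
    (hn : ν.parts 0 ≤ n) (hc : ¬ (κ ≤ ν ∧ κ.len = ν.len)) :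
    ∏ j ∈ Finset.range n, brow b h (κ.parts j) (ν.parts j) (ν.parts (j + 1)) = 0 := by
  by_contra h0
  have h1 : ∀ i, κ.parts i ≤ ν.parts i ∧ (κ.parts i = 0 ↔ ν.parts i = 0) := by
    intro i
    by_cases hi : i < n
    · by_contra hc
      exact h0 (Finset.prod_eq_zero (Finset.mem_range.2 hi) (if_neg hc))
    · rw [parts_eq_zero_of_le ν (by omega), parts_eq_zero_of_le κ (by omega)]
      simp
  have hle : κ ≤ ν := fun i => (h1 i).1
  exact hc ⟨hle, (len_eq_len_iff hle).2 fun i => (h1 i).2⟩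

end StrictPartition
-- Shifted diagrams as order ideals, extended tableaux and letter sets
namespace StrictPartition

theorem mem_SD_of_col {η : StrictPartition} {i i' j : ℕ} (h : i ≤ i') (hη : (i', j) ∈ η.SD) :
    (i, j) ∈ η.SD := by
  rw [mem_SD] at hη ⊢
  have := η.add_parts_antitone h (by omega)
  omega

theorem mem_SD_of_row {η : StrictPartition} {i j j' : ℕ} (hi : i ≤ j) (h : j ≤ j')
    (hη : (i, j') ∈ η.SD) : (i, j) ∈ η.SD := by
  rw [mem_SD] at hη ⊢
  omega

theorem SD_subset_iff {ν μ : StrictPartition} : ν.SD ⊆ μ.SD ↔ ν ≤ μ := by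
  constructor
  · intro h i
    by_contra hlt
    have h1 : (i, i + μ.parts i) ∈ μ.SD := h ((mem_SD _ _ _).2 (by omega))
    rw [mem_SD] at h1
    omega
  · rintro h ⟨i, j⟩ hp
    have := h i
    rw [mem_SD] at hp ⊢
    omega

/-- An order ideal of boxes is a shifted diagram. -/
theorem exists_SD_eq (D : Finset (ℕ × ℕ)) (hd : ∀ i j, (i, j) ∈ D → i ≤ j)
    (hr : ∀ i j, i ≤ j → (i, j + 1) ∈ D → (i, j) ∈ D)
    (hc : ∀ i j, (i + 1, j) ∈ D → (i, j) ∈ D) : ∃ η : StrictPartition, η.SD = D := by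
  classical
  have hex : ∀ i, ∃ k, (i, i + k) ∉ D := by
    intro i
    by_contra hall
    push Not at hall
    have hinf : Set.Infinite (Set.range fun k : ℕ => ((i, i + k) : ℕ × ℕ)) :=
      Set.infinite_range_of_injective fun k k' h => by
        simpa using h
    exact hinf (D.finite_toSet.subset (by rintro _ ⟨k, rfl⟩; exact hall k))
  have hmem : ∀ i k, (i, i + k) ∈ D ↔ k < Nat.find (hex i) := by
    intro i k
    constructor
    · intro h
      by_contra hlt
      have hdown : ∀ d, (i, i + (Nat.find (hex i) + d)) ∈ D → (i, i + Nat.find (hex i)) ∈ D := by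
        intro d
        induction d with
        | zero => exact id
        | succ d ih => exact fun h => ih (hr _ _ (by omega) h)
      refine Nat.find_spec (hex i) (hdown (k - Nat.find (hex i)) ?_)
      rwa [Nat.add_sub_cancel' (by omega)]
    · intro h
      have := Nat.find_min (hex i) h
      exact not_not.1 this
  refine ⟨⟨fun i => Nat.find (hex i), fun i hi => ?_, fun i hi => ?_⟩, ?_⟩
  · by_contra hlt
    have h1 := (hmem (i + 1) (Nat.find (hex i) - 1)).2 (by omega)
    rw [show i + 1 + (Nat.find (hex i) - 1) = i + Nat.find (hex i) by omega] at h1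
    exact Nat.find_spec (hex i) (hc _ _ h1)
  · by_contra hne
    have h1 := hr _ _ le_rfl (hc _ _ ((hmem (i + 1) 0).2 (by omega)))
    have h2 := (hmem i 0).1 h1
    omega
  · ext ⟨i, j⟩
    rw [mem_SD]
    constructor
    · rintro ⟨h1, h2⟩
      obtain ⟨k, rfl⟩ := Nat.exists_eq_add_of_le h1
      exact (hmem i k).2 (by simpa using h2)
    · intro h
      have h1 := hd i j h
      obtain ⟨k, rfl⟩ := Nat.exists_eq_add_of_le h1
      exact ⟨h1, by simpa using (hmem i k).1 h⟩

/-- Erasing a box leaves an order ideal exactly when no box lies directly to its right or directly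
below it, and order ideals are shifted diagrams by `exists_SD_eq`. -/
theorem mem_Rem {ν : StrictPartition} {i j : ℕ} :
    (i, j) ∈ Rem ν ↔ (i, j) ∈ ν.SD ∧ (i, j + 1) ∉ ν.SD ∧ (i + 1, j) ∉ ν.SD := by
  constructor
  · rintro ⟨h, ρ, hρ⟩
    have hn : (i, j) ∉ ρ.SD := by rw [hρ]; exact Finset.notMem_erase _ _
    refine ⟨h, fun h1 => hn ?_, fun h1 => hn ?_⟩
    · refine mem_SD_of_row (mem_SD _ _ _ |>.1 h).1 (Nat.le_succ j) ?_
      rw [hρ]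
      exact Finset.mem_erase.2 ⟨by simp, h1⟩
    · refine mem_SD_of_col (Nat.le_succ i) ?_
      rw [hρ]
      exact Finset.mem_erase.2 ⟨by simp, h1⟩
  · rintro ⟨h, h1, h2⟩
    refine ⟨h, exists_SD_eq _ (fun a b hab => ?_) (fun a b hab h' => ?_) fun a b h' => ?_⟩
    · exact ((mem_SD _ _ _).1 (Finset.mem_of_mem_erase hab)).1
    · rw [Finset.mem_erase] at h' ⊢
      refine ⟨?_, mem_SD_of_row hab (Nat.le_succ b) h'.2⟩
      rintro ⟨⟩
      exact h1 h'.2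
    · rw [Finset.mem_erase] at h' ⊢
      refine ⟨?_, mem_SD_of_col (Nat.le_succ a) h'.2⟩
      rintro ⟨⟩
      exact h2 h'.2

/-- The conditions on the entries of a semistandard set-valued shifted tableau. If `f` holds,
then there is no primed number on the diagonal. -/
structure IsSemistandard (f : Bool) (T : Filling) : Prop where
  row : ∀ i j j', j < j' → ∀ a ∈ T (i, j), ∀ b ∈ T (i, j'), a < b ∨ (a = b ∧ Odd a)
  col : ∀ i i' j, i < i' → ∀ a ∈ T (i, j), ∀ b ∈ T (i', j), a < b ∨ (a = b ∧ Even a)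
  diag : f = true → ∀ i, ∀ a ∈ T (i, i), Odd a

/-- A tableau of shape `μ//ν` with entries less than `N`: besides the boxes of `μ/ν`, also the
removable boxes of `ν` may have entries. -/
structure IsExtended (f : Bool) (N : ℕ) (μ ν : StrictPartition) (T : Filling) : Prop
    extends IsSemistandard f T where
  le : ν ≤ μ
  nonempty : ∀ p ∈ skewSD μ ν, (T p).Nonempty
  mem : ∀ p, (T p).Nonempty → p ∈ skewSD μ ν ∨ p ∈ Rem ν
  lt : ∀ p, ∀ a ∈ T p, a < N

theorem IsExtended.mem_SD {f : Bool} {N : ℕ} {μ ν : StrictPartition} {T : Filling}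
    (hT : IsExtended f N μ ν T) {p : ℕ × ℕ} {a : ℕ} (ha : a ∈ T p) : p ∈ μ.SD := by
  rcases hT.mem p ⟨a, ha⟩ with h | h
  · exact (Finset.mem_sdiff.1 h).1
  · exact SD_subset_iff.2 hT.le h.1

/-- A possible set of the boxes that contain the letter `N` in a tableau of shape `μ//η`
that has no other letters. -/
structure IsLetterSet (f : Bool) (N : ℕ) (μ η : StrictPartition) (S : Finset (ℕ × ℕ)) : Prop where
  le : η ≤ μ
  subset : skewSD μ η ⊆ S
  mem : ∀ p ∈ S, p ∈ skewSD μ η ∨ p ∈ Rem η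
  row : ∀ i j j', j < j' → (i, j) ∈ S → (i, j') ∈ S → Odd N
  col : ∀ i i' j, i < i' → (i, j) ∈ S → (i', j) ∈ S → Even N
  diag : f = true → ∀ i, (i, i) ∈ S → Odd N

theorem IsLetterSet.mem_SD {f : Bool} {N : ℕ} {μ η : StrictPartition} {S : Finset (ℕ × ℕ)}
    (hS : IsLetterSet f N μ η S) {p : ℕ × ℕ} (hp : p ∈ S) : p ∈ μ.SD := by
  rcases hS.mem p hp with h | h
  · exact (Finset.mem_sdiff.1 h).1
  · exact SD_subset_iff.2 hS.le h.1

/-- A letter box lies outside `η` or is a corner of it. With `notMem_below` this guarantees that no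
smaller letter follows the new one in a row or column. -/
theorem IsLetterSet.notMem_right {f : Bool} {N : ℕ} {μ η : StrictPartition} {S : Finset (ℕ × ℕ)}
    (hS : IsLetterSet f N μ η S) {i j j' : ℕ} (hp : (i, j) ∈ S) (hj : j < j') :
    (i, j') ∉ η.SD := by
  intro h
  have hij := (StrictPartition.mem_SD _ _ _).1 (hS.mem_SD hp)
  rcases hS.mem _ hp with h1 | h1
  · exact (Finset.mem_sdiff.1 h1).2 (mem_SD_of_row hij.1 hj.le h)
  · exact (mem_Rem.1 h1).2.1 (mem_SD_of_row (by omega) hj h)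

theorem IsLetterSet.notMem_below {f : Bool} {N : ℕ} {μ η : StrictPartition} {S : Finset (ℕ × ℕ)}
    (hS : IsLetterSet f N μ η S) {i i' j : ℕ} (hp : (i, j) ∈ S) (hi : i < i') :
    (i', j) ∉ η.SD := by
  intro h
  rcases hS.mem _ hp with h1 | h1
  · exact (Finset.mem_sdiff.1 h1).2 (mem_SD_of_col hi.le h)
  · exact (mem_Rem.1 h1).2.2 (mem_SD_of_col hi h)

theorem extended_finite (f : Bool) (N : ℕ) (μ ν : StrictPartition) :
    {T | IsExtended f N μ ν T}.Finite := by
  let e : Filling → (μ.SD → Finset ℕ) := fun T p => T p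
  refine Set.Finite.of_finite_image (f := e) ?_ ?_
  · have hfin : (Set.univ.pi fun _ : μ.SD =>
        ((Finset.range N).powerset : Set (Finset ℕ))).Finite :=
      Set.Finite.pi fun _ => Finset.finite_toSet _
    refine hfin.subset ?_
    rintro _ ⟨T, hT, rfl⟩ ⟨p, hp⟩ -
    simp only [Finset.coe_powerset, Set.mem_preimage, Set.mem_powerset_iff, Finset.coe_subset]
    intro a ha
    exact Finset.mem_range.2 (hT.lt p a ha)
  · rintro T hT T' hT' h
    funext p
    by_cases hp : p ∈ μ.SD
    · exact congrFun h ⟨p, hp⟩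
    · rw [Finset.eq_empty_of_forall_notMem fun a ha => hp (hT.mem_SD ha),
        Finset.eq_empty_of_forall_notMem fun a ha => hp (hT'.mem_SD ha)]

theorem letterSet_finite (f : Bool) (N : ℕ) (μ η : StrictPartition) :
    {S | IsLetterSet f N μ η S}.Finite :=
  (μ.SD.powerset.finite_toSet).subset fun _ hS =>
    Finset.mem_coe.2 (Finset.mem_powerset.2 fun _ hp => IsLetterSet.mem_SD hS hp)

end StrictPartition
-- Adding and removing the largest letter
namespace StrictPartition
variable {f : Bool} {N : ℕ} {μ ν η : StrictPartition}

/-- The filling obtained by adding the letter `N` to the boxes in `S`. -/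
def addLetter (N : ℕ) (S : Finset (ℕ × ℕ)) (T : Filling) : Filling :=
  fun p => if p ∈ S then insert N (T p) else T p

/-- The filling obtained by removing the letter `N`. -/
def removeLetter (N : ℕ) (T : Filling) : Filling := fun p => (T p).erase N

/-- The boxes that contain the letter `N`. -/
def letterBoxes (N : ℕ) (μ : StrictPartition) (T : Filling) : Finset (ℕ × ℕ) :=
  μ.SD.filter fun p => N ∈ T p

theorem mem_addLetter {S : Finset (ℕ × ℕ)} {T : Filling} {p : ℕ × ℕ} {a : ℕ} :
    a ∈ addLetter N S T p ↔ (p ∈ S ∧ a = N) ∨ a ∈ T p := by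
  unfold addLetter
  split_ifs with h <;> simp [h]

theorem mem_removeLetter {T : Filling} {p : ℕ × ℕ} {a : ℕ} :
    a ∈ removeLetter N T p ↔ a ≠ N ∧ a ∈ T p := Finset.mem_erase

theorem IsExtended.mem_letterBoxes {T : Filling} {M : ℕ} (hT : IsExtended f M μ ν T)
    {p : ℕ × ℕ} : p ∈ letterBoxes N μ T ↔ N ∈ T p := by
  rw [letterBoxes, Finset.mem_filter]
  exact ⟨fun h => h.2, fun h => ⟨hT.mem_SD h, h⟩⟩

/-- The shape occupied by all letters but the largest. -/
theorem IsExtended.exists_inner {T : Filling} (hT : IsExtended f (N + 1) μ ν T) :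
    ∃ η : StrictPartition, ∀ p, p ∈ η.SD ↔ p ∈ ν.SD ∨ (removeLetter N T p).Nonempty := by
  have hmem : ∀ p, p ∈ ν.SD ∪ μ.SD.filter (fun p => (removeLetter N T p).Nonempty) ↔
      p ∈ ν.SD ∨ (removeLetter N T p).Nonempty := by
    intro p
    rw [Finset.mem_union, Finset.mem_filter]
    refine or_congr_right ⟨fun h => h.2, fun h => ⟨?_, h⟩⟩
    obtain ⟨a, ha⟩ := h
    exact hT.mem_SD (mem_removeLetter.1 ha).2
  have hsmall : ∀ p q, p ∈ μ.SD → (∀ a ∈ T p, ∀ b ∈ T q, a ≤ b) →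
      (removeLetter N T q).Nonempty → p ∈ ν.SD ∨ (removeLetter N T p).Nonempty := by
    intro p q hp hpq ⟨b, hb⟩
    rw [mem_removeLetter] at hb
    by_cases hpν : p ∈ ν.SD
    · exact Or.inl hpν
    · right
      obtain ⟨a, ha⟩ := hT.nonempty p (Finset.mem_sdiff.2 ⟨hp, hpν⟩)
      have h1 := hpq a ha b hb.2
      have h2 := hT.lt q b hb.2
      exact ⟨a, mem_removeLetter.2 ⟨by omega, ha⟩⟩
  have hμ : ∀ p, p ∈ ν.SD ∨ (removeLetter N T p).Nonempty → p ∈ μ.SD := by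
    rintro p (h | ⟨a, ha⟩)
    · exact SD_subset_iff.2 hT.le h
    · exact hT.mem_SD (mem_removeLetter.1 ha).2
  obtain ⟨η, hη⟩ := exists_SD_eq (ν.SD ∪ μ.SD.filter (fun p => (removeLetter N T p).Nonempty))
    (fun i j h => ((StrictPartition.mem_SD _ _ _).1 (hμ _ ((hmem _).1 h))).1)
    (fun i j hij h => by
      rw [hmem] at h ⊢
      have hp := mem_SD_of_row hij (Nat.le_succ j) (hμ _ h)
      rcases h with h | h
      · exact Or.inl (mem_SD_of_row hij (Nat.le_succ j) h)
      · refine hsmall _ _ hp (fun a ha b hb => ?_) h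
        rcases hT.row i j (j + 1) (Nat.lt_succ_self j) a ha b hb with h | h
        · exact h.le
        · exact h.1.le)
    (fun i j h => by
      rw [hmem] at h ⊢
      have hp := mem_SD_of_col (Nat.le_succ i) (hμ _ h)
      rcases h with h | h
      · exact Or.inl (mem_SD_of_col (Nat.le_succ i) h)
      · refine hsmall _ _ hp (fun a ha b hb => ?_) h
        rcases hT.col i (i + 1) j (Nat.lt_succ_self i) a ha b hb with h | h
        · exact h.le
        · exact h.1.le)
  exact ⟨η, fun p => by rw [hη, hmem]⟩

theorem IsExtended.remove {T : Filling} (hT : IsExtended f (N + 1) μ ν T)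
    (hη : ∀ p, p ∈ η.SD ↔ p ∈ ν.SD ∨ (removeLetter N T p).Nonempty) :
    IsExtended f N η ν (removeLetter N T) where
  le := SD_subset_iff.1 fun p hp => (hη p).2 (Or.inl hp)
  nonempty p hp := by
    rw [skewSD, Finset.mem_sdiff, hη] at hp
    tauto
  mem p hp := by
    by_cases hν : p ∈ ν.SD
    · obtain ⟨a, ha⟩ := hp
      rcases hT.mem p ⟨a, (mem_removeLetter.1 ha).2⟩ with h | h
      · exact absurd hν (Finset.mem_sdiff.1 h).2
      · exact Or.inr h
    · exact Or.inl (Finset.mem_sdiff.2 ⟨(hη p).2 (Or.inr hp), hν⟩)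
  lt p a ha := by
    rw [mem_removeLetter] at ha
    have := hT.lt p a ha.2
    omega
  row i j j' h a ha b hb :=
    hT.row i j j' h a (mem_removeLetter.1 ha).2 b (mem_removeLetter.1 hb).2
  col i i' j h a ha b hb :=
    hT.col i i' j h a (mem_removeLetter.1 ha).2 b (mem_removeLetter.1 hb).2
  diag hf i a ha := hT.diag hf i a (mem_removeLetter.1 ha).2

/-- A box of `η` containing the maximal letter `N` must be a corner of `η`: a box of `η` to its
right or below would either contain a smaller letter, against monotonicity, or belong to `ν`,
whereas filled boxes of `ν` are corners of `ν`. -/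
theorem IsExtended.isLetterSet {T : Filling} (hT : IsExtended f (N + 1) μ ν T)
    (hη : ∀ p, p ∈ η.SD ↔ p ∈ ν.SD ∨ (removeLetter N T p).Nonempty) :
    IsLetterSet f N μ η (letterBoxes N μ T) where
  le := SD_subset_iff.1 fun p hp => by
    rcases (hη p).1 hp with h | ⟨a, ha⟩
    · exact SD_subset_iff.2 hT.le h
    · exact hT.mem_SD (mem_removeLetter.1 ha).2
  subset p hp := by
    rw [skewSD, Finset.mem_sdiff, hη, not_or] at hp
    obtain ⟨a, ha⟩ := hT.nonempty p (Finset.mem_sdiff.2 ⟨hp.1, hp.2.1⟩)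
    have haN : a = N := by
      by_contra hne
      exact hp.2.2 ⟨a, mem_removeLetter.2 ⟨hne, ha⟩⟩
    rw [hT.mem_letterBoxes]
    rwa [← haN]
  mem p hp := by
    rw [hT.mem_letterBoxes] at hp
    have hpμ := hT.mem_SD hp
    by_cases hpη : p ∈ η.SD
    · right
      obtain ⟨i, j⟩ := p
      have hRem : ∀ q, (i, j) ∈ ν.SD → (q = (i, j + 1) ∨ q = (i + 1, j)) → q ∉ ν.SD := by
        intro q hν hq
        rcases hT.mem _ ⟨N, hp⟩ with h | h
        · exact absurd hν (Finset.mem_sdiff.1 h).2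
        · rw [mem_Rem] at h
          rcases hq with rfl | rfl
          · exact h.2.1
          · exact h.2.2
      have hij := ((StrictPartition.mem_SD _ _ _).1 hpμ).1
      refine mem_Rem.2 ⟨hpη, fun h => ?_, fun h => ?_⟩
      · rcases (hη _).1 h with h1 | ⟨b, hb⟩
        · exact hRem _ (mem_SD_of_row hij (Nat.le_succ j) h1) (Or.inl rfl) h1
        · rw [mem_removeLetter] at hb
          have h2 := hT.row i j (j + 1) (Nat.lt_succ_self j) N hp b hb.2
          have h3 := hT.lt _ b hb.2
          omega
      · rcases (hη _).1 h with h1 | ⟨b, hb⟩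
        · exact hRem _ (mem_SD_of_col (Nat.le_succ i) h1) (Or.inr rfl) h1
        · rw [mem_removeLetter] at hb
          have h2 := hT.col i (i + 1) j (Nat.lt_succ_self i) N hp b hb.2
          have h3 := hT.lt _ b hb.2
          omega
    · exact Or.inl (Finset.mem_sdiff.2 ⟨hpμ, hpη⟩)
  row i j j' h hp hp' := by
    rw [hT.mem_letterBoxes] at hp hp'
    rcases hT.row i j j' h N hp N hp' with h | h
    · omega
    · exact h.2
  col i i' j h hp hp' := by
    rw [hT.mem_letterBoxes] at hp hp'
    rcases hT.col i i' j h N hp N hp' with h | h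
    · omega
    · exact h.2
  diag hf i hp := by
    rw [hT.mem_letterBoxes] at hp
    exact hT.diag hf i N hp

/-- A box of `ν` that receives `N` is a corner of the larger shape `η`, hence a corner of `ν`, so
the result is again a tableau of the extended kind. -/
theorem IsExtended.add {T : Filling} {S : Finset (ℕ × ℕ)} (hT : IsExtended f N η ν T)
    (hS : IsLetterSet f N μ η S) : IsExtended f (N + 1) μ ν (addLetter N S T) where
  le i := (hT.le i).trans (hS.le i)
  nonempty p hp := by
    rw [skewSD, Finset.mem_sdiff] at hp
    by_cases hpη : p ∈ η.SD
    · obtain ⟨a, ha⟩ := hT.nonempty p (Finset.mem_sdiff.2 ⟨hpη, hp.2⟩)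
      exact ⟨a, mem_addLetter.2 (Or.inr ha)⟩
    · exact ⟨N, mem_addLetter.2 (Or.inl ⟨hS.subset (Finset.mem_sdiff.2 ⟨hp.1, hpη⟩), rfl⟩)⟩
  mem p hp := by
    obtain ⟨a, ha⟩ := hp
    have hpμ : p ∈ μ.SD := by
      rcases mem_addLetter.1 ha with h | h
      · exact hS.mem_SD h.1
      · exact SD_subset_iff.2 hS.le (hT.mem_SD h)
    by_cases hpν : p ∈ ν.SD
    · right
      rcases mem_addLetter.1 ha with h | h
      · rcases hS.mem p h.1 with h1 | h1
        · exact absurd (SD_subset_iff.2 hT.le hpν) (Finset.mem_sdiff.1 h1).2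
        · obtain ⟨i, j⟩ := p
          rw [mem_Rem] at h1 ⊢
          exact ⟨hpν, fun h2 => h1.2.1 (SD_subset_iff.2 hT.le h2),
            fun h2 => h1.2.2 (SD_subset_iff.2 hT.le h2)⟩
      · rcases hT.mem p ⟨a, h⟩ with h1 | h1
        · exact absurd hpν (Finset.mem_sdiff.1 h1).2
        · exact h1
    · exact Or.inl (Finset.mem_sdiff.2 ⟨hpμ, hpν⟩)
  lt p a ha := by
    rcases mem_addLetter.1 ha with h | h
    · omega
    · have := hT.lt p a h
      omega
  row i j j' hj a ha b hb := by
    rcases mem_addLetter.1 ha with h | h <;> rcases mem_addLetter.1 hb with h' | h'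
    · exact Or.inr ⟨h.2.trans h'.2.symm, h.2 ▸ hS.row i j j' hj h.1 h'.1⟩
    · exact absurd (hT.mem_SD h') (hS.notMem_right h.1 hj)
    · exact Or.inl (h'.2 ▸ hT.lt _ a h)
    · exact hT.row i j j' hj a h b h'
  col i i' j hi a ha b hb := by
    rcases mem_addLetter.1 ha with h | h <;> rcases mem_addLetter.1 hb with h' | h'
    · exact Or.inr ⟨h.2.trans h'.2.symm, h.2 ▸ hS.col i i' j hi h.1 h'.1⟩
    · exact absurd (hT.mem_SD h') (hS.notMem_below h.1 hi)
    · exact Or.inl (h'.2 ▸ hT.lt _ a h)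
    · exact hT.col i i' j hi a h b h'
  diag hf i a ha := by
    rcases mem_addLetter.1 ha with h | h
    · exact h.2 ▸ hS.diag hf i h.1
    · exact hT.diag hf i a h

theorem IsExtended.removeLetter_addLetter {T : Filling} (hT : IsExtended f N η ν T)
    (S : Finset (ℕ × ℕ)) : removeLetter N (addLetter N S T) = T := by
  funext p
  ext a
  rw [mem_removeLetter, mem_addLetter]
  constructor
  · rintro ⟨h1, h2⟩
    tauto
  · intro h
    have := hT.lt p a h
    exact ⟨by omega, Or.inr h⟩

theorem IsExtended.letterBoxes_addLetter {T : Filling} {S : Finset (ℕ × ℕ)}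
    (hT : IsExtended f N η ν T) (hS : IsLetterSet f N μ η S) :
    letterBoxes N μ (addLetter N S T) = S := by
  ext p
  rw [(hT.add hS).mem_letterBoxes, mem_addLetter]
  constructor
  · rintro (h | h)
    · exact h.1
    · have := hT.lt p N h
      omega
  · exact fun h => Or.inl ⟨h, rfl⟩

theorem IsExtended.addLetter_removeLetter {T : Filling} {M : ℕ} (hT : IsExtended f M μ ν T) :
    addLetter N (letterBoxes N μ T) (removeLetter N T) = T := by
  funext p
  ext a
  rw [mem_addLetter, mem_removeLetter, hT.mem_letterBoxes]
  by_cases h : a = N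
  · subst h; simp
  · simp [h]

/-- The intermediate shape is determined by the filling, which makes the decomposition by the
largest letter injective. -/
theorem IsExtended.mem_inner_iff {T : Filling} (hT : IsExtended f N η ν T) (p : ℕ × ℕ) :
    p ∈ η.SD ↔ p ∈ ν.SD ∨ (T p).Nonempty := by
  constructor
  · intro h
    by_cases hν : p ∈ ν.SD
    · exact Or.inl hν
    · exact Or.inr (hT.nonempty p (Finset.mem_sdiff.2 ⟨h, hν⟩))
  · rintro (h | ⟨a, ha⟩)
    · exact SD_subset_iff.2 hT.le h
    · exact hT.mem_SD ha

end StrictPartition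
-- Generating functions of extended tableaux
namespace StrictPartition
variable {R : Type*} [CommRing R]

/-- The generating function of the tableaux of shape `μ//ν` with entries less than `N`, where the
letter `a` has weight `y a`. -/
noncomputable def tableauSum (β : R) (y : ℕ → R) (f : Bool) (N : ℕ) (μ ν : StrictPartition) : R :=
  ∑ T ∈ (extended_finite f N μ ν).toFinset,
    (∏ p ∈ μ.SD, ∏ a ∈ T p, y a) * β ^ (entryCount μ.SD T - skewSize μ ν)

/-- The generating function of the tableaux of shape `μ//η` with the only letter `N`, of
weight `x`. -/
noncomputable def letterSum (β x : R) (f : Bool) (N : ℕ) (μ η : StrictPartition) : R :=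
  ∑ S ∈ (letterSet_finite f N μ η).toFinset, x ^ S.card * β ^ (S.card - skewSize μ η)

variable {f : Bool} {N : ℕ} {μ ν η : StrictPartition}

theorem prod_addLetter (y : ℕ → R) {T : Filling} {S : Finset (ℕ × ℕ)} (hT : IsExtended f N η ν T)
    (hS : IsLetterSet f N μ η S) :
    ∏ p ∈ μ.SD, ∏ a ∈ addLetter N S T p, y a =
      y N ^ S.card * ∏ p ∈ η.SD, ∏ a ∈ T p, y a := by
  have h1 : ∀ p, ∏ a ∈ addLetter N S T p, y a =
      (if p ∈ S then y N else 1) * ∏ a ∈ T p, y a := by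
    intro p
    unfold addLetter
    split_ifs with h
    · rw [Finset.prod_insert fun h => (hT.lt p N h).false]
    · rw [one_mul]
  rw [Finset.prod_congr rfl fun p _ => h1 p, Finset.prod_mul_distrib, ← Finset.prod_filter,
    Finset.prod_const]
  congr 1
  · congr 2
    ext p
    rw [Finset.mem_filter]
    exact ⟨fun h => h.2, fun h => ⟨hS.mem_SD h, h⟩⟩
  · symm
    refine Finset.prod_subset (SD_subset_iff.2 hS.le) fun p _ hp => ?_
    rw [Finset.eq_empty_of_forall_notMem fun a ha => hp (hT.mem_SD ha), Finset.prod_empty]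

theorem entryCount_addLetter {T : Filling} {S : Finset (ℕ × ℕ)} (hT : IsExtended f N η ν T)
    (hS : IsLetterSet f N μ η S) :
    entryCount μ.SD (addLetter N S T) = S.card + entryCount η.SD T := by
  have h1 : ∀ p, (addLetter N S T p).card = (if p ∈ S then 1 else 0) + (T p).card := by
    intro p
    unfold addLetter
    split_ifs with h
    · rw [Finset.card_insert_of_notMem fun h => (hT.lt p N h).false, add_comm]
    · rw [zero_add]
  rw [entryCount, Finset.sum_congr rfl fun p _ => h1 p, Finset.sum_add_distrib,
    ← Finset.card_filter]
  congr 1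
  · congr 1
    ext p
    rw [Finset.mem_filter]
    exact ⟨fun h => h.2, fun h => ⟨hS.mem_SD h, h⟩⟩
  · symm
    refine Finset.sum_subset (SD_subset_iff.2 hS.le) fun p _ hp => ?_
    rw [Finset.eq_empty_of_forall_notMem fun a ha => hp (hT.mem_SD ha), Finset.card_empty]

theorem skewSize_add_skewSize (h1 : ν ≤ η) (h2 : η ≤ μ) :
    skewSize μ η + skewSize η ν = skewSize μ ν := by
  rw [← SD_subset_iff] at h1 h2
  rw [skewSize, skewSize, skewSize, skewSD, skewSD, skewSD, Finset.card_sdiff_of_subset h2,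
    Finset.card_sdiff_of_subset h1, Finset.card_sdiff_of_subset (h1.trans h2)]
  have := Finset.card_le_card h1
  have := Finset.card_le_card h2
  omega

theorem IsExtended.skewSize_le {T : Filling} (hT : IsExtended f N η ν T) :
    skewSize η ν ≤ entryCount η.SD T := by
  rw [skewSize, Finset.card_eq_sum_ones]
  refine (Finset.sum_le_sum fun p hp => ?_).trans
    (Finset.sum_le_sum_of_subset (Finset.sdiff_subset : skewSD η ν ⊆ η.SD))
  exact Finset.card_pos.2 (hT.nonempty p hp)

/-- The largest letter of a tableau can be split off. -/
theorem tableauSum_succ (β : R) (y : ℕ → R) {M : ℕ} (hμ : μ.parts 0 ≤ M) :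
    tableauSum β y f (N + 1) μ ν =
      ∑ η ∈ bounded M, letterSum β (y N) f N μ η * tableauSum β y f N η ν := by
  classical
  simp only [tableauSum, letterSum, Finset.sum_mul_sum]
  simp only [← Finset.sum_product']
  rw [Finset.sum_sigma']
  symm
  refine Finset.sum_bij (fun x _ => addLetter N x.2.1 x.2.2) ?_ ?_ ?_ ?_
  · rintro ⟨η, S, T⟩ h
    simp only [Finset.mem_sigma, Finset.mem_product, Set.Finite.mem_toFinset,
      Set.mem_setOf_eq] at h ⊢
    exact h.2.2.add h.2.1
  · rintro ⟨η, S, T⟩ h ⟨η', S', T'⟩ h' he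
    simp only [Finset.mem_sigma, Finset.mem_product, Set.Finite.mem_toFinset,
      Set.mem_setOf_eq] at h h' he
    have hT : T = T' := by
      rw [← h.2.2.removeLetter_addLetter S, he, h'.2.2.removeLetter_addLetter S']
    have hS : S = S' := by
      rw [← h.2.2.letterBoxes_addLetter h.2.1, he, h'.2.2.letterBoxes_addLetter h'.2.1]
    have hη : η = η' := by
      apply SD_injective
      ext p
      rw [h.2.2.mem_inner_iff, h'.2.2.mem_inner_iff, hT]
    subst hT hS hη
    rfl
  · intro T hT
    simp only [Set.Finite.mem_toFinset, Set.mem_setOf_eq] at hT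
    obtain ⟨η, hη⟩ := hT.exists_inner
    refine ⟨⟨η, letterBoxes N μ T, removeLetter N T⟩, ?_, hT.addLetter_removeLetter⟩
    simp only [Finset.mem_sigma, Finset.mem_product, Set.Finite.mem_toFinset, Set.mem_setOf_eq,
      mem_bounded]
    have hS := hT.isLetterSet hη
    exact ⟨(hS.le 0).trans hμ, hS, hT.remove hη⟩
  · rintro ⟨η, S, T⟩ h
    simp only [Finset.mem_sigma, Finset.mem_product, Set.Finite.mem_toFinset,
      Set.mem_setOf_eq] at h
    obtain ⟨-, hS, hT⟩ := h
    dsimp only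
    rw [prod_addLetter y hT hS, entryCount_addLetter hT hS]
    -- The exponents of β are truncated differences; these bounds make them add up.
    have h1 := hT.skewSize_le
    have h2 : skewSize μ η ≤ S.card := Finset.card_le_card hS.subset
    have h3 := skewSize_add_skewSize hT.le hS.le
    rw [show S.card + entryCount η.SD T - skewSize μ ν = (S.card - skewSize μ η) +
      (entryCount η.SD T - skewSize η ν) by omega, pow_add]
    ring

theorem tableauSum_zero (β : R) (y : ℕ → R) [Decidable (μ = ν)] :
    tableauSum β y f 0 μ ν = if μ = ν then 1 else 0 := by
  have h : ∀ T, IsExtended f 0 μ ν T ↔ μ = ν ∧ T = fun _ => ∅ := by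
    intro T
    constructor
    · intro hT
      have hemp : ∀ p, T p = ∅ := fun p =>
        Finset.eq_empty_of_forall_notMem fun a ha => by have := hT.lt p a ha; omega
      refine ⟨SD_injective (Finset.Subset.antisymm (fun p hp => ?_) (SD_subset_iff.2 hT.le)),
        funext hemp⟩
      by_contra hn
      have := hT.nonempty p (Finset.mem_sdiff.2 ⟨hp, hn⟩)
      rw [hemp] at this
      exact Finset.not_nonempty_empty this
    · rintro ⟨rfl, rfl⟩
      refine ⟨⟨?_, ?_, ?_⟩, fun _ => le_rfl, ?_, ?_, ?_⟩ <;> simp [skewSD]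
  rw [tableauSum]
  split_ifs with he
  · have : (extended_finite f 0 μ ν).toFinset = {fun _ => ∅} := by
      ext T
      rw [Set.Finite.mem_toFinset, Set.mem_setOf_eq, h, Finset.mem_singleton]
      exact ⟨fun h => h.2, fun h => ⟨he, h⟩⟩
    rw [this]
    simp [entryCount]
  · have : (extended_finite f 0 μ ν).toFinset = ∅ := by
      ext T
      simp [h, he]
    rw [this, Finset.sum_empty]

end StrictPartition
-- Evaluation of the one-letter matrices
namespace StrictPartition
variable {R : Type*} [CommRing R]
variable {f : Bool} {N n : ℕ} {μ η : StrictPartition}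

theorem letterSum_eq_zero (β x : R) (h : ∀ S, ¬ IsLetterSet f N μ η S) :
    letterSum β x f N μ η = 0 :=
  Finset.sum_eq_zero fun S hS => absurd (by simpa using hS) (h S)

/-- The letter is forced in `μ/η` and may be chosen freely in `F`, each choice costing `x * β`; the
sum over subsets of `F` is the binomial theorem. -/
theorem letterSum_eq_pow (β x : R) (F : Finset (ℕ × ℕ)) (hF : Disjoint (skewSD μ η) F)
    (h : ∀ S, IsLetterSet f N μ η S ↔ skewSD μ η ⊆ S ∧ S ⊆ skewSD μ η ∪ F) :
    letterSum β x f N μ η = x ^ skewSize μ η * (1 + x * β) ^ F.card := by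
  have h1 : letterSum β x f N μ η =
      ∑ U ∈ F.powerset, x ^ skewSize μ η * ((x * β) ^ U.card * 1 ^ (F.card - U.card)) := by
    symm
    refine Finset.sum_bij (fun U _ => skewSD μ η ∪ U) ?_ ?_ ?_ ?_
    · intro U hU
      rw [Set.Finite.mem_toFinset, Set.mem_setOf_eq, h]
      exact ⟨Finset.subset_union_left,
        Finset.union_subset_union_right (Finset.mem_powerset.1 hU)⟩
    · intro U hU U' hU' he
      rw [Finset.mem_powerset] at hU hU'
      rw [← Finset.union_sdiff_cancel_left (hF.mono_right hU), he,
        Finset.union_sdiff_cancel_left (hF.mono_right hU')]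
    · intro S hS
      rw [Set.Finite.mem_toFinset, Set.mem_setOf_eq, h] at hS
      refine ⟨S \ skewSD μ η, ?_, Finset.union_sdiff_of_subset hS.1⟩
      rw [Finset.mem_powerset]
      intro p hp
      rw [Finset.mem_sdiff] at hp
      exact (Finset.mem_union.1 (hS.2 hp.1)).resolve_left hp.2
    · intro U hU
      rw [Finset.card_union_of_disjoint (hF.mono_right (Finset.mem_powerset.1 hU)), ← skewSize,
        Nat.add_sub_cancel_left, one_pow, mul_one, pow_add, mul_pow, mul_assoc]
  rw [h1, ← Finset.mul_sum, Finset.sum_pow_mul_eq_add_pow, add_comm]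

theorem mem_Rem_iff {i j : ℕ} : (i, j) ∈ Rem η ↔
    0 < η.parts i ∧ j + 1 = i + η.parts i ∧ (η.parts (i + 1) + 1 < η.parts i ∨ η.parts i = 1) := by
  rw [mem_Rem, mem_SD, mem_SD, mem_SD]
  have := η.descends i
  unfold Descends at this
  omega

open Classical in
/-- The removable boxes of `η` that may contain a primed letter which fills `μ/η`. -/
noncomputable def freeBoxesPrimed (f : Bool) (μ η : StrictPartition) : Finset (ℕ × ℕ) :=
  η.SD.filter fun p => p ∈ Rem η ∧ μ.parts p.1 ≤ η.parts p.1 ∧ ¬ (f = true ∧ p.1 = p.2)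

open Classical in
/-- The removable boxes of `η` that may contain an unprimed letter which fills `μ/η`. -/
noncomputable def freeBoxesUnprimed (μ η : StrictPartition) : Finset (ℕ × ℕ) :=
  η.SD.filter fun p => p ∈ Rem η ∧ (p.1 + 1, p.2) ∉ μ.SD

theorem mem_freeBoxesPrimed {i j : ℕ} : (i, j) ∈ freeBoxesPrimed f μ η ↔
    (i, j) ∈ Rem η ∧ μ.parts i ≤ η.parts i ∧ ¬ (f = true ∧ i = j) := by
  simp only [freeBoxesPrimed, Finset.mem_filter]
  exact ⟨fun h => h.2, fun h => ⟨h.1.1, h⟩⟩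

theorem mem_freeBoxesUnprimed {i j : ℕ} : (i, j) ∈ freeBoxesUnprimed μ η ↔
    (i, j) ∈ Rem η ∧ (i + 1, j) ∉ μ.SD := by
  simp only [freeBoxesUnprimed, Finset.mem_filter]
  exact ⟨fun h => h.2, fun h => ⟨h.1.1, h⟩⟩

/-- A primed letter occurs at most once in a row, so a removable box is available only in a row that
does not grow, and not on the diagonal if `f` holds. Columns impose nothing. -/
theorem isLetterSet_iff_of_even (hN : Even N) (hle : η ≤ μ)
    (hv : ∀ i, μ.parts i ≤ η.parts i + 1 ∧ ¬ (f = true ∧ η.parts i = 0 ∧ μ.parts i = 1))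
    (S : Finset (ℕ × ℕ)) : IsLetterSet f N μ η S ↔
      skewSD μ η ⊆ S ∧ S ⊆ skewSD μ η ∪ freeBoxesPrimed f μ η := by
  have hodd : ¬ Odd N := Nat.not_odd_iff_even.2 hN
  constructor
  · intro hS
    refine ⟨hS.subset, ?_⟩
    rintro ⟨i, j⟩ hp
    rw [Finset.mem_union, mem_freeBoxesPrimed]
    by_cases hD : (i, j) ∈ skewSD μ η
    · exact Or.inl hD
    · have hR := (hS.mem _ hp).resolve_left hD
      refine Or.inr ⟨hR, ?_, ?_⟩
      · by_contra hlt
        rw [mem_Rem_iff] at hR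
        refine hodd (hS.row i j (i + η.parts i) (by omega) hp (hS.subset ?_))
        rw [mem_skewSD]
        omega
      · rintro ⟨hf, rfl⟩
        exact hodd (hS.diag hf i hp)
  · rintro ⟨h1, h2⟩
    have hS : ∀ i j, (i, j) ∈ S → (i, j) ∈ skewSD μ η ∨
        ((i, j) ∈ Rem η ∧ μ.parts i ≤ η.parts i ∧ ¬ (f = true ∧ i = j)) := by
      intro i j hp
      have := h2 hp
      rwa [Finset.mem_union, mem_freeBoxesPrimed] at this
    refine ⟨hle, h1, fun p hp => ?_, fun i j j' hj hp hp' => ?_, fun _ _ _ _ _ _ => hN,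
      fun hf i hp => ?_⟩
    · exact (hS p.1 p.2 hp).imp_right fun h => h.1
    · exfalso
      have h3 := hS i j hp
      have h4 := hS i j' hp'
      rw [mem_skewSD, mem_Rem_iff] at h3 h4
      have := (hv i).1
      omega
    · exfalso
      have h3 := hS i i hp
      have h4 := (hv i).2
      rw [mem_skewSD] at h3
      have h5 := (hv i).1
      rcases h3 with h3 | h3
      · exact h4 ⟨hf, by omega, by omega⟩
      · exact h3.2.2 ⟨hf, rfl⟩

/-- An unprimed letter occurs at most once in a column, so a removable box is available only if the
box below it stays outside `μ`. Rows and the diagonal impose nothing. -/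
theorem isLetterSet_iff_of_odd (hN : Odd N) (hle : η ≤ μ)
    (hv : ∀ i, μ.parts (i + 1) < η.parts i ∨ μ.parts (i + 1) = 0)
    (S : Finset (ℕ × ℕ)) : IsLetterSet f N μ η S ↔
      skewSD μ η ⊆ S ∧ S ⊆ skewSD μ η ∪ freeBoxesUnprimed μ η := by
  have heven : ¬ Even N := Nat.not_even_iff_odd.2 hN
  constructor
  · intro hS
    refine ⟨hS.subset, ?_⟩
    rintro ⟨i, j⟩ hp
    rw [Finset.mem_union, mem_freeBoxesUnprimed]
    by_cases hD : (i, j) ∈ skewSD μ η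
    · exact Or.inl hD
    · have hR := (hS.mem _ hp).resolve_left hD
      refine Or.inr ⟨hR, fun hμ => ?_⟩
      exact heven (hS.col i (i + 1) j (Nat.lt_succ_self i) hp
        (hS.subset (Finset.mem_sdiff.2 ⟨hμ, (mem_Rem.1 hR).2.2⟩)))
  · rintro ⟨h1, h2⟩
    refine ⟨hle, h1, fun p hp => ?_, fun _ _ _ _ _ _ => hN, fun i i' j hi hp hp' => ?_,
      fun _ _ _ => hN⟩
    · refine (Finset.mem_union.1 (h2 hp)).imp_right fun h => ?_
      obtain ⟨i, j⟩ := p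
      exact (mem_freeBoxesUnprimed.1 h).1
    · exfalso
      have h3 := Finset.mem_union.1 (h2 hp)
      have h4 := Finset.mem_union.1 (h2 hp')
      rw [mem_freeBoxesUnprimed] at h3 h4
      have hμ : (i', j) ∈ μ.SD := by
        rcases h4 with h4 | h4
        · exact (Finset.mem_sdiff.1 h4).1
        · exact SD_subset_iff.2 hle h4.1.1
      have hμ' := mem_SD_of_col (i := i + 1) hi hμ
      rcases h3 with h3 | h3
      · rcases h4 with h4 | h4
        · rw [mem_skewSD] at h3
          rw [mem_SD] at hμ'
          have := hv i
          omega
        · exact (Finset.mem_sdiff.1 h3).2 (mem_SD_of_col hi.le h4.1.1)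
      · exact h3.2 hμ'

theorem disjoint_freeBoxesPrimed : Disjoint (skewSD μ η) (freeBoxesPrimed f μ η) := by
  rw [Finset.disjoint_left]
  rintro ⟨i, j⟩ h1 h2
  exact (Finset.mem_sdiff.1 h1).2 (mem_freeBoxesPrimed.1 h2).1.1

theorem disjoint_freeBoxesUnprimed : Disjoint (skewSD μ η) (freeBoxesUnprimed μ η) := by
  rw [Finset.disjoint_left]
  rintro ⟨i, j⟩ h1 h2
  exact (Finset.mem_sdiff.1 h1).2 (mem_freeBoxesUnprimed.1 h2).1.1

/-- Each row has at most one removable box, its last one, and that box is diagonal exactly when the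
row has length 1. -/
theorem card_freeBoxesPrimed (hn : η.parts 0 ≤ n) (hle : η ≤ μ) :
    (freeBoxesPrimed f μ η).card = ∑ i ∈ Finset.range n,
      if μ.parts i = η.parts i ∧ 0 < η.parts i ∧
        (η.parts (i + 1) + 1 < η.parts i ∨ η.parts i = 1) ∧ ¬ (f = true ∧ η.parts i = 1)
      then 1 else 0 := by
  rw [card_eq_sum_rows _ (fun i => i + η.parts i - 1) (fun i => if μ.parts i = η.parts i ∧
    0 < η.parts i ∧ (η.parts (i + 1) + 1 < η.parts i ∨ η.parts i = 1) ∧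
    ¬ (f = true ∧ η.parts i = 1) then i + η.parts i else 0) n]
  · refine Finset.sum_congr rfl fun i _ => ?_
    split_ifs <;> omega
  · intro i j
    rw [mem_freeBoxesPrimed, mem_Rem_iff]
    have h1 := hle i
    have h2 := lt_of_parts_pos (i := i) hn
    split_ifs with h
    · obtain ⟨h3, h4, h5, h6⟩ := h
      constructor
      · rintro ⟨h7, -, -⟩
        omega
      · intro h7
        refine ⟨by omega, h3.le, fun h8 => h6 ⟨h8.1, by omega⟩⟩
    · constructor
      · rintro ⟨h3, h4, h5⟩
        exact absurd ⟨by omega, h3.1, h3.2.2, fun h6 => h5 ⟨h6.1, by omega⟩⟩ h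
      · omega

theorem card_freeBoxesUnprimed (hn : η.parts 0 ≤ n) (hle : η ≤ μ) :
    (freeBoxesUnprimed μ η).card = ∑ i ∈ Finset.range n,
      if 0 < η.parts i ∧ (μ.parts (i + 1) + 1 < η.parts i ∨ η.parts i = 1) then 1 else 0 := by
  rw [card_eq_sum_rows _ (fun i => i + η.parts i - 1) (fun i => if 0 < η.parts i ∧
    (μ.parts (i + 1) + 1 < η.parts i ∨ η.parts i = 1) then i + η.parts i else 0) n]
  · refine Finset.sum_congr rfl fun i _ => ?_
    split_ifs <;> omega
  · intro i j
    rw [mem_freeBoxesUnprimed, mem_Rem_iff, mem_SD]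
    have h1 := hle (i + 1)
    have h2 := lt_of_parts_pos (i := i) hn
    split_ifs <;> omega

/-- The entries of the one-letter matrix of a primed letter. -/
theorem letterSum_of_even (hN : Even N) (x b : R) (hμ : μ.parts 0 ≤ n) (hη : η.parts 0 ≤ n) :
    letterSum (-(2 * b)) x f N μ η =
      ∏ i ∈ Finset.range n, vrow f x b (μ.parts i) (η.parts i) (η.parts (i + 1)) := by
  by_cases hv : ∀ i, η.parts i ≤ μ.parts i ∧ μ.parts i ≤ η.parts i + 1 ∧
      ¬ (f = true ∧ η.parts i = 0 ∧ μ.parts i = 1)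
  · have hle : η ≤ μ := fun i => (hv i).1
    rw [letterSum_eq_pow _ _ _ disjoint_freeBoxesPrimed
      (isLetterSet_iff_of_even hN hle fun i => (hv i).2), card_freeBoxesPrimed hη hle,
      skewSize_eq_sum hμ, ← Finset.prod_pow_eq_pow_sum, ← Finset.prod_pow_eq_pow_sum,
      ← Finset.prod_mul_distrib]
    refine Finset.prod_congr rfl fun i _ => ?_
    -- With β equal to `-(2 * b)`, a free box contributes `1 + x * β = 1 - 2 * (b * x)`.
    rw [vrow, if_pos (hv i)]
    congr 1
    split_ifs <;> ring
  · rw [letterSum_eq_zero]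
    · push Not at hv
      obtain ⟨i, hi⟩ := hv
      symm
      refine Finset.prod_eq_zero (i := i) (Finset.mem_range.2 ?_) (if_neg ?_)
      · by_contra hin
        rw [parts_eq_zero_of_le μ (by omega), parts_eq_zero_of_le η (by omega)] at hi
        simp at hi
      · tauto
    · intro S hS
      refine hv fun i => ⟨hS.le i, ?_, ?_⟩
      · by_contra hlt
        refine Nat.not_odd_iff_even.2 hN (hS.row i (i + η.parts i) (i + η.parts i + 1)
          (Nat.lt_succ_self _) (hS.subset ?_) (hS.subset ?_)) <;>
        · rw [mem_skewSD]
          omega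
      · rintro ⟨hf, h1, h2⟩
        refine Nat.not_odd_iff_even.2 hN (hS.diag hf i (hS.subset ?_))
        rw [mem_skewSD]
        omega

/-- The entries of the one-letter matrix of an unprimed letter. -/
theorem letterSum_of_odd (hN : Odd N) (x b : R) (hμ : μ.parts 0 ≤ n) (hη : η.parts 0 ≤ n) :
    letterSum (-(2 * b)) x f N μ η =
      ∏ i ∈ Finset.range n, hrow x b (μ.parts i) (η.parts i) (μ.parts (i + 1)) := by
  by_cases hv : ∀ i, η.parts i ≤ μ.parts i ∧
      (μ.parts (i + 1) < η.parts i ∨ μ.parts (i + 1) = 0)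
  · have hle : η ≤ μ := fun i => (hv i).1
    rw [letterSum_eq_pow _ _ _ disjoint_freeBoxesUnprimed
      (isLetterSet_iff_of_odd hN hle fun i => (hv i).2), card_freeBoxesUnprimed hη hle,
      skewSize_eq_sum hμ, ← Finset.prod_pow_eq_pow_sum, ← Finset.prod_pow_eq_pow_sum,
      ← Finset.prod_mul_distrib]
    refine Finset.prod_congr rfl fun i _ => ?_
    rw [hrow, if_pos (hv i)]
    congr 1
    split_ifs <;> ring
  · rw [letterSum_eq_zero]
    · push Not at hv
      obtain ⟨i, hi⟩ := hv
      symm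
      refine Finset.prod_eq_zero (i := i) (Finset.mem_range.2 ?_) (if_neg ?_)
      · by_contra hin
        rw [parts_eq_zero_of_le μ (i := i) (by omega), parts_eq_zero_of_le η (by omega),
          parts_eq_zero_of_le μ (i := i + 1) (by omega)] at hi
        simp at hi
      · intro h
        have := hi h.1
        omega
    · intro S hS
      refine hv fun i => ⟨hS.le i, ?_⟩
      by_contra hlt
      have h1 := η.descends i
      have h2 := μ.descends i
      unfold Descends at h1 h2
      refine Nat.not_even_iff_odd.2 hN (hS.col i (i + 1) (i + μ.parts (i + 1))
        (Nat.lt_succ_self _) (hS.subset ?_) (hS.subset ?_)) <;>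
      · rw [mem_skewSD]
        omega

end StrictPartition
-- Iteration over the variables
namespace StrictPartition
variable {R : Type*} [CommRing R]

theorem tableauSum_eq_zero {f : Bool} {N : ℕ} {μ ν : StrictPartition} (β : R) (y : ℕ → R)
    (h : ¬ ν ≤ μ) : tableauSum β y f N μ ν = 0 :=
  Finset.sum_eq_zero fun T hT => absurd (IsExtended.le (by simpa using hT)) h

/-- An entry of the change of basis matrix. -/
def basisChange (b : R) (n : ℕ) (ν κ : StrictPartition) : R :=
  ∏ j ∈ Finset.range n, arow b (ν.parts j) (κ.parts j) (ν.parts (j + 1)) (κ.parts (j + 1))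

/-- An entry of the inverse change of basis matrix. -/
def basisChangeInv (b h : R) (n : ℕ) (κ ν : StrictPartition) : R :=
  ∏ j ∈ Finset.range n, brow b h (κ.parts j) (ν.parts j) (ν.parts (j + 1))

/-- An entry of the one-variable matrix. -/
def oneVariable (f : Bool) (x b : R) (n : ℕ) (μ ν : StrictPartition) : R :=
  ∏ j ∈ Finset.range n,
    wrow f x b (μ.parts j) (ν.parts j) (μ.parts (j + 1)) (ν.parts (j + 1))

variable {b : R} {μ ν κ : StrictPartition} {N n : ℕ}

/-- The last variable can be split off. -/
theorem tableauSum_two_mul_succ (f : Bool) (b : R) (x : ℕ → R) (K : ℕ) (ν : StrictPartition)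
    (hμ : μ.parts 0 ≤ N) (hn : N ≤ n) :
    tableauSum (-(2 * b)) (fun a => x (a / 2)) f (2 * (K + 1)) μ ν =
      ∑ ξ ∈ bounded N, oneVariable f (x K) b n μ ξ *
        tableauSum (-(2 * b)) (fun a => x (a / 2)) f (2 * K) ξ ν := by
  rw [show 2 * (K + 1) = 2 * K + 1 + 1 by ring, tableauSum_succ _ _ hμ]
  have h1 : ∀ η ∈ bounded N,
      letterSum (-(2 * b)) (x ((2 * K + 1) / 2)) f (2 * K + 1) μ η *
        tableauSum (-(2 * b)) (fun a => x (a / 2)) f (2 * K + 1) η ν =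
      ∑ ξ ∈ bounded N,
        ((∏ i ∈ Finset.range n, hrow (x K) b (μ.parts i) (η.parts i) (μ.parts (i + 1))) *
          ∏ i ∈ Finset.range n, vrow f (x K) b (η.parts i) (ξ.parts i) (ξ.parts (i + 1))) *
        tableauSum (-(2 * b)) (fun a => x (a / 2)) f (2 * K) ξ ν := by
    intro η hη
    rw [mem_bounded] at hη
    rw [tableauSum_succ _ _ hη, show (2 * K + 1) / 2 = K by omega,
      letterSum_of_odd (odd_two_mul_add_one K) _ _ (hμ.trans hn) (hη.trans hn), Finset.mul_sum]
    refine Finset.sum_congr rfl fun ξ hξ => ?_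
    rw [mem_bounded] at hξ
    rw [show 2 * K / 2 = K by omega,
      letterSum_of_even (even_two_mul K) _ _ (hη.trans hn) (hξ.trans hn), mul_assoc]
  rw [Finset.sum_congr rfl h1, Finset.sum_comm]
  refine Finset.sum_congr rfl fun ξ _ => ?_
  rw [← Finset.sum_mul, sum_prod_hrow_mul_prod_vrow (x K) b f ξ hμ hn, oneVariable]

theorem oneVariable_eq_zero (f : Bool) (x b : R) (hn : 0 < n) (h : μ.parts 0 < ν.parts 0) :
    oneVariable f x b n μ ν = 0 :=
  Finset.prod_eq_zero (Finset.mem_range.2 hn) (wrow_of_not (Or.inl h))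

theorem sum_oneVariable_mul_basisChange (x b : R) (hμ : μ.parts 0 + 1 ≤ N) (hκ : κ.parts 0 ≤ N)
    (hn : N ≤ n) :
    ∑ ν ∈ bounded N, oneVariable false x b n μ ν * basisChange b n ν κ =
      ∑ ν ∈ bounded N, basisChange b n μ ν * oneVariable true x b n ν κ := by
  simp only [oneVariable, basisChange, ← Finset.prod_mul_distrib]
  exact sum_prod_weightL_eq x b hμ hκ hn

/-- The change of basis matrix intertwines the two kinds of tableau sums. -/
theorem sum_tableauSum_mul_basisChange (b : R) (x : ℕ → R) (K : ℕ) (hμ : μ.parts 0 + 1 ≤ N)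
    (hκ : κ.parts 0 ≤ N) (hn : N ≤ n) :
    ∑ ν ∈ bounded N, tableauSum (-(2 * b)) (fun a => x (a / 2)) false (2 * K) μ ν *
        basisChange b n ν κ =
      ∑ ν ∈ bounded N, basisChange b n μ ν *
        tableauSum (-(2 * b)) (fun a => x (a / 2)) true (2 * K) ν κ := by
  classical
  induction K generalizing μ with
  | zero =>
    -- Without variables both tableau matrices are the identity.
    simp only [mul_zero, tableauSum_zero, ite_mul, mul_ite, one_mul, mul_one, zero_mul]
    rw [Finset.sum_ite_eq, Finset.sum_ite_eq', if_pos (mem_bounded.2 (by omega)),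
      if_pos (mem_bounded.2 hκ)]
  | succ K ih =>
    simp only [tableauSum_two_mul_succ false b x K _ (show μ.parts 0 ≤ N by omega) hn]
    simp only [Finset.sum_mul]
    rw [Finset.sum_comm]
    have h1 : ∀ ξ ∈ bounded N, ∑ ν ∈ bounded N, oneVariable false (x K) b n μ ξ *
        tableauSum (-(2 * b)) (fun a => x (a / 2)) false (2 * K) ξ ν * basisChange b n ν κ =
        ∑ ν ∈ bounded N, oneVariable false (x K) b n μ ξ * basisChange b n ξ ν *
          tableauSum (-(2 * b)) (fun a => x (a / 2)) true (2 * K) ν κ := by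
      intro ξ _
      simp only [mul_assoc, ← Finset.mul_sum]
      -- The induction hypothesis needs room below `N` for the first part to grow; partitions
      -- without that room are not reached, since the one-variable matrix never enlarges the first
      -- part.
      by_cases hξ : ξ.parts 0 ≤ μ.parts 0
      · rw [ih (by omega)]
      · rw [oneVariable_eq_zero _ _ _ (by omega) (by omega), zero_mul, zero_mul]
    rw [Finset.sum_congr rfl h1, Finset.sum_comm]
    have h2 : ∀ ν ∈ bounded N, ∑ ξ ∈ bounded N, oneVariable false (x K) b n μ ξ *
        basisChange b n ξ ν * tableauSum (-(2 * b)) (fun a => x (a / 2)) true (2 * K) ν κ =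
        ∑ ξ ∈ bounded N, basisChange b n μ ξ * (oneVariable true (x K) b n ξ ν *
          tableauSum (-(2 * b)) (fun a => x (a / 2)) true (2 * K) ν κ) := by
      intro ν hν
      rw [← Finset.sum_mul, sum_oneVariable_mul_basisChange _ _ hμ (mem_bounded.1 hν) hn,
        Finset.sum_mul]
      exact Finset.sum_congr rfl fun ξ _ => mul_assoc _ _ _
    rw [Finset.sum_congr rfl h2, Finset.sum_comm]
    refine Finset.sum_congr rfl fun ξ hξ => ?_
    rw [← Finset.mul_sum, tableauSum_two_mul_succ true b x K κ (mem_bounded.1 hξ) hn]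

/-- The expansion of a tableau sum with primed diagonal entries into those without. -/
theorem tableauSum_false_eq_sum (b h : R) (hh : 2 * h = 1) (x : ℕ → R) (K : ℕ) (hνμ : ν ≤ μ)
    (hμ : μ.parts 0 + 1 ≤ N) (hn : N ≤ n) :
    tableauSum (-(2 * b)) (fun a => x (a / 2)) false (2 * K) μ ν =
      ∑ κ ∈ bounded N, ∑ l ∈ bounded N, basisChange b n μ l *
        tableauSum (-(2 * b)) (fun a => x (a / 2)) true (2 * K) l κ *
          basisChangeInv b h n κ ν := by
  classical
  have h1 : ∀ κ ∈ bounded N, ∑ l ∈ bounded N, basisChange b n μ l *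
      tableauSum (-(2 * b)) (fun a => x (a / 2)) true (2 * K) l κ * basisChangeInv b h n κ ν =
      ∑ ρ ∈ bounded N, tableauSum (-(2 * b)) (fun a => x (a / 2)) false (2 * K) μ ρ *
        (basisChange b n ρ κ * basisChangeInv b h n κ ν) := by
    intro κ hκ
    rw [← Finset.sum_mul, ← sum_tableauSum_mul_basisChange b x K hμ (mem_bounded.1 hκ) hn,
      Finset.sum_mul]
    exact Finset.sum_congr rfl fun ξ _ => mul_assoc _ _ _
  rw [Finset.sum_congr rfl h1, Finset.sum_comm]
  have hν0 := hνμ 0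
  have h2 : ∀ ρ ∈ bounded N, ∑ κ ∈ bounded N,
      tableauSum (-(2 * b)) (fun a => x (a / 2)) false (2 * K) μ ρ *
        (basisChange b n ρ κ * basisChangeInv b h n κ ν) =
      if ρ = ν then tableauSum (-(2 * b)) (fun a => x (a / 2)) false (2 * K) μ ρ else 0 := by
    intro ρ _
    rw [← Finset.mul_sum]
    -- The inverse relation requires `ρ.parts 0 + 1 ≤ N`, which follows from `ρ ≤ μ`; all other `ρ`
    -- have vanishing tableau sum.
    by_cases hρ : ρ ≤ μ
    · have hρ0 := hρ 0
      have := sum_prod_weightInv (b := b) (ν := ρ) (ρ := ν) hh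
        (show ρ.parts 0 + 1 ≤ N by omega) (by omega) hn
      simp only [weightInv, Finset.prod_mul_distrib] at this
      simp only [basisChange, basisChangeInv, this, mul_ite, mul_one, mul_zero]
    · rw [tableauSum_eq_zero _ _ hρ, zero_mul, ite_self]
  rw [Finset.sum_congr rfl h2, Finset.sum_ite_eq', if_pos (mem_bounded.2 (by omega))]

end StrictPartition
-- From set-valued tableaux to extended tableaux
namespace StrictPartition

theorem isSemistandard_of_isSetShYTQ {f : Bool} {μ ρ : StrictPartition} {T : Filling}
    (hT : IsSetShYTQ μ ρ T) (hd : f = true → ∀ i, ∀ a ∈ T (i, i), Odd a) :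
    IsSemistandard f T where
  row i j j' h a ha b hb := by
    rcases (hT.row_le i j j' h a ha b hb).lt_or_eq with hab | rfl
    · exact Or.inl hab
    · refine Or.inr ⟨rfl, ?_⟩
      by_contra hodd
      exact hT.row_primed i j j' h a (Nat.not_odd_iff_even.1 hodd) ha hb
  col i i' j h a ha b hb := by
    rcases (hT.col_le i i' j h a ha b hb).lt_or_eq with hab | rfl
    · exact Or.inl hab
    · refine Or.inr ⟨rfl, ?_⟩
      by_contra heven
      exact hT.col_unprimed i i' j h a (Nat.not_even_iff_odd.1 heven) ha hb
  diag := hd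

theorem IsSemistandard.isSetShYTQ {f : Bool} {μ ρ : StrictPartition} {T : Filling}
    (hT : IsSemistandard f T) (hle : ρ ≤ μ) (hne : ∀ p, (T p).Nonempty ↔ p ∈ skewSD μ ρ) :
    IsSetShYTQ μ ρ T where
  le := hle
  nonempty_iff := hne
  row_le i j j' h a ha b hb := by
    rcases hT.row i j j' h a ha b hb with hab | hab
    · exact hab.le
    · exact hab.1.le
  col_le i i' j h a ha b hb := by
    rcases hT.col i i' j h a ha b hb with hab | hab
    · exact hab.le
    · exact hab.1.le
  col_unprimed i i' j h a hodd ha hb := by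
    rcases hT.col i i' j h a ha a hb with hab | hab
    · exact lt_irrefl a hab
    · exact Nat.not_even_iff_odd.2 hodd hab.2
  row_primed i j j' h a heven ha hb := by
    rcases hT.row i j j' h a ha a hb with hab | hab
    · exact lt_irrefl a hab
    · exact Nat.not_odd_iff_even.2 heven hab.2

section
variable {f : Bool} {K : ℕ} {μ ν ρ : StrictPartition} {T : Filling} {m : ℕ →₀ ℕ}

theorem weight_skewSD_eq (hne : ∀ p, (T p).Nonempty ↔ p ∈ skewSD μ ρ) :
    weight (skewSD μ ρ) T = weight μ.SD T := by
  refine Finset.sum_subset Finset.sdiff_subset fun p _ hp => ?_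
  rw [← hne, Finset.not_nonempty_iff_eq_empty] at hp
  rw [hp, Finset.sum_empty]

theorem entryCount_skewSD_eq (hne : ∀ p, (T p).Nonempty ↔ p ∈ skewSD μ ρ) :
    entryCount (skewSD μ ρ) T = entryCount μ.SD T := by
  refine Finset.sum_subset Finset.sdiff_subset fun p _ hp => ?_
  rw [← hne, Finset.not_nonempty_iff_eq_empty] at hp
  rw [hp, Finset.card_empty]

theorem weight_pos {D : Finset (ℕ × ℕ)} {p : ℕ × ℕ} {a : ℕ} (hp : p ∈ D) (ha : a ∈ T p) :
    0 < weight D T (a / 2) := by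
  rw [weight, Finsupp.finsetSum_apply]
  refine Finset.sum_pos' (fun _ _ => Nat.zero_le _) ⟨p, hp, ?_⟩
  rw [Finsupp.finsetSum_apply]
  exact Finset.sum_pos' (fun _ _ => Nat.zero_le _) ⟨a, ha, by simp⟩

/-- The shape that is left after the removal of the boxes of `ν` that have entries. -/
theorem IsExtended.exists_remSub (hT : IsExtended f K μ ν T) :
    ∃ ρ ∈ remSub ν, ∀ p, (T p).Nonempty ↔ p ∈ skewSD μ ρ := by
  have hRem : ∀ p ∈ ν.SD, (T p).Nonempty → p ∈ Rem ν := fun p hp hne =>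
    (hT.mem p hne).resolve_left fun h => (Finset.mem_sdiff.1 h).2 hp
  obtain ⟨ρ, hρ⟩ := exists_SD_eq (ν.SD.filter fun p => ¬ (T p).Nonempty)
    (fun i j h => ((StrictPartition.mem_SD _ _ _).1 (Finset.mem_filter.1 h).1).1)
    (fun i j hij h => by
      rw [Finset.mem_filter] at h ⊢
      have hp := mem_SD_of_row hij (Nat.le_succ j) h.1
      exact ⟨hp, fun hne => (mem_Rem.1 (hRem _ hp hne)).2.1 h.1⟩)
    (fun i j h => by
      rw [Finset.mem_filter] at h ⊢
      have hp := mem_SD_of_col (Nat.le_succ i) h.1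
      exact ⟨hp, fun hne => (mem_Rem.1 (hRem _ hp hne)).2.2 h.1⟩)
  refine ⟨ρ, ⟨SD_subset_iff.1 (hρ ▸ Finset.filter_subset _ _), ?_⟩, fun p => ?_⟩
  · intro p hp
    rw [Finset.mem_coe, skewSD, hρ, Finset.mem_sdiff, Finset.mem_filter] at hp
    exact hRem p hp.1 (by tauto)
  · rw [skewSD, hρ, Finset.mem_sdiff, Finset.mem_filter]
    constructor
    · intro h
      obtain ⟨a, ha⟩ := id h
      exact ⟨hT.mem_SD ha, fun h' => h'.2 h⟩
    · rintro ⟨h1, h2⟩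
      by_cases hν : p ∈ ν.SD
      · tauto
      · exact hT.nonempty p (Finset.mem_sdiff.2 ⟨h1, hν⟩)

theorem isExtended_of_isSetShYTQ (hνμ : ν ≤ μ) (hρ : ρ ∈ remSub ν) (hT : IsSetShYTQ μ ρ T)
    (hd : f = true → ∀ i, ∀ a ∈ T (i, i), Odd a) (hw : weight (skewSD μ ρ) T = m)
    (hm : ∀ k ∈ m.support, k < K) : IsExtended f (2 * K) μ ν T where
  toIsSemistandard := isSemistandard_of_isSetShYTQ hT hd
  le := hνμ
  nonempty p hp := by
    rw [hT.nonempty_iff]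
    rw [skewSD, Finset.mem_sdiff] at hp ⊢
    exact ⟨hp.1, fun h => hp.2 (SD_subset_iff.2 hρ.1 h)⟩
  mem p hp := by
    rw [hT.nonempty_iff, skewSD, Finset.mem_sdiff] at hp
    by_cases hν : p ∈ ν.SD
    · exact Or.inr (hρ.2 (Finset.mem_coe.2 (Finset.mem_sdiff.2 ⟨hν, hp.2⟩)))
    · exact Or.inl (Finset.mem_sdiff.2 ⟨hp.1, hν⟩)
  lt p a ha := by
    have h1 := weight_pos ((hT.nonempty_iff p).1 ⟨a, ha⟩) ha
    rw [hw] at h1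
    have := hm (a / 2) (Finsupp.mem_support_iff.2 h1.ne')
    omega

/-- The tableaux whose shape is `μ/ρ`, where `ρ` arises from `ν` by removal of boxes, are the
tableaux of shape `μ//ν`. -/
theorem sum_remSub_eq_sum_extended {A : Type*} [CommSemiring A] (c : A) (hνμ : ν ≤ μ)
    (hm : ∀ k ∈ m.support, k < K) (S : StrictPartition → Finset Filling)
    (hS : ∀ ρ T, T ∈ S ρ ↔ (IsSetShYTQ μ ρ T ∧ (f = true → ∀ i, ∀ a ∈ T (i, i), Odd a)) ∧
      weight (skewSD μ ρ) T = m) :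
    ∑ ρ ∈ (remSub_finite ν).toFinset, c ^ skewSize ν ρ *
        ∑ T ∈ S ρ, c ^ (entryCount (skewSD μ ρ) T - skewSize μ ρ) =
      ∑ T ∈ (extended_finite f (2 * K) μ ν).toFinset with weight μ.SD T = m,
        c ^ (entryCount μ.SD T - skewSize μ ν) := by
  simp only [Finset.mul_sum]
  rw [Finset.sum_sigma']
  refine Finset.sum_bij (fun x _ => x.2) ?_ ?_ ?_ ?_
  · rintro ⟨ρ, T⟩ h
    rw [Finset.mem_sigma, Set.Finite.mem_toFinset, hS] at h
    obtain ⟨hρ, ⟨hT, hd⟩, hw⟩ := h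
    rw [Finset.mem_filter, Set.Finite.mem_toFinset, ← weight_skewSD_eq hT.nonempty_iff]
    exact ⟨isExtended_of_isSetShYTQ hνμ hρ hT hd hw hm, hw⟩
  · rintro ⟨ρ, T⟩ h ⟨ρ', T'⟩ h' (rfl : T = T')
    rw [Finset.mem_sigma, Set.Finite.mem_toFinset, hS] at h h'
    -- The inner shape is the complement of the filled boxes in `μ`, so the filling determines it.
    have : ρ = ρ' := by
      apply SD_injective
      ext p
      have h1 := h.2.1.1.nonempty_iff p
      have h2 := h'.2.1.1.nonempty_iff p
      rw [skewSD, Finset.mem_sdiff] at h1 h2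
      have h3 : p ∈ ρ.SD → p ∈ μ.SD := fun hp => SD_subset_iff.2 h.2.1.1.le hp
      have h4 : p ∈ ρ'.SD → p ∈ μ.SD := fun hp => SD_subset_iff.2 h'.2.1.1.le hp
      dsimp only at h1 h2 h3 h4
      tauto
    subst this
    rfl
  · intro T hT
    rw [Finset.mem_filter, Set.Finite.mem_toFinset] at hT
    obtain ⟨hT, hw⟩ := hT
    have hT' : IsExtended f (2 * K) μ ν T := hT
    obtain ⟨ρ, hρ, hne⟩ := hT'.exists_remSub
    refine ⟨⟨ρ, T⟩, ?_, rfl⟩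
    rw [Finset.mem_sigma, Set.Finite.mem_toFinset, hS]
    exact ⟨hρ, ⟨hT'.isSetShYTQ (fun i => (hρ.1 i).trans (hνμ i)) hne, hT'.diag⟩,
      (weight_skewSD_eq hne).trans hw⟩
  · rintro ⟨ρ, T⟩ h
    rw [Finset.mem_sigma, Set.Finite.mem_toFinset, hS] at h
    obtain ⟨hρ, ⟨hT, hd⟩, hw⟩ := h
    dsimp only at hρ hT ⊢
    -- The factor with exponent `|ν/ρ|` turns `|T| - |μ/ρ|` into `|T| - |μ/ν|`, which does not
    -- depend on `ρ`.
    have h1 := skewSize_add_skewSize hρ.1 hνμ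
    have h2 : skewSize μ ρ ≤ entryCount (skewSD μ ρ) T := by
      rw [skewSize, Finset.card_eq_sum_ones]
      exact Finset.sum_le_sum fun p hp => Finset.card_pos.2 ((hT.nonempty_iff p).2 hp)
    rw [← pow_add, ← entryCount_skewSD_eq hT.nonempty_iff]
    congr 1
    omega

end

open MvPowerSeries in
theorem coeff_tableauSum (c : Polynomial ℚ) (f : Bool) (N : ℕ) (μ ν : StrictPartition)
    (m : ℕ →₀ ℕ) :
    coeff m (tableauSum (C c) (fun a => X (a / 2)) f N μ ν : MvPowerSeries ℕ (Polynomial ℚ)) =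
      ∑ T ∈ (extended_finite f N μ ν).toFinset with weight μ.SD T = m,
        c ^ (entryCount μ.SD T - skewSize μ ν) := by
  have hprod : ∀ T : Filling, (∏ p ∈ μ.SD, ∏ a ∈ T p, X (a / 2) :
      MvPowerSeries ℕ (Polynomial ℚ)) = monomial (weight μ.SD T) 1 := by
    intro T
    have hprod' : ∀ (s : Finset (ℕ × ℕ)) (g : ℕ × ℕ → ℕ →₀ ℕ),
        ∏ p ∈ s, (monomial (g p) 1 : MvPowerSeries ℕ (Polynomial ℚ)) =
          monomial (∑ p ∈ s, g p) 1 := by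
      intro s g
      induction s using Finset.cons_induction with
      | empty => simp
      | cons p s hp ih =>
        rw [Finset.prod_cons, Finset.sum_cons, ih, monomial_mul_monomial, one_mul]
    rw [weight, ← hprod']
    refine Finset.prod_congr rfl fun p _ => ?_
    induction T p using Finset.cons_induction with
    | empty => simp
    | cons a s ha ih =>
      rw [Finset.prod_cons, Finset.sum_cons, ih, X, monomial_mul_monomial, one_mul]
  rw [tableauSum, map_sum, Finset.sum_filter]
  refine Finset.sum_congr rfl fun T _ => ?_
  rw [hprod, ← map_pow, coeff_mul_C, coeff_monomial, ite_mul, one_mul, zero_mul]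
  simp only [eq_comm]

open MvPowerSeries in
-- A tableau whose weight is `m` only uses letters below `2 * K`, so the finite tableau sum has the
-- same coefficient at `m` as the full power series.
theorem coeff_toRat_GQQ {K : ℕ} {μ ν : StrictPartition} {m : ℕ →₀ ℕ} (hνμ : ν ≤ μ)
    (hm : ∀ k ∈ m.support, k < K) :
    coeff m (toRat (GQQ μ ν)) =
      coeff m (tableauSum (C Polynomial.X) (fun a => X (a / 2)) false (2 * K) μ ν) := by
  rw [coeff_tableauSum, ← sum_remSub_eq_sum_extended (f := false) Polynomial.X hνμ hm
    (fun ρ => (tableauxQ_finite μ ρ m).toFinset) (by intro ρ T; simp [tableauxQ]),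
    toRat, coeff_map, GQQ, if_pos hνμ]
  simp only [map_sum, map_smul, smul_eq_mul, map_mul, map_pow, Polynomial.coe_mapRingHom,
    Polynomial.map_X]
  refine Finset.sum_congr rfl fun ρ _ => ?_
  congr 1
  rw [show coeff m (GQ μ ρ) = GQ μ ρ m from rfl, GQ, Polynomial.map_sum]
  simp

open MvPowerSeries in
theorem coeff_toRat_GPP {K : ℕ} {μ ν : StrictPartition} {m : ℕ →₀ ℕ} (hνμ : ν ≤ μ)
    (hm : ∀ k ∈ m.support, k < K) :
    coeff m (toRat (GPP μ ν)) =
      coeff m (tableauSum (C Polynomial.X) (fun a => X (a / 2)) true (2 * K) μ ν) := by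
  rw [coeff_tableauSum, ← sum_remSub_eq_sum_extended (f := true) Polynomial.X hνμ hm
    (fun ρ => (tableauxP_finite μ ρ m).toFinset) ?_,
    toRat, coeff_map, GPP, if_pos hνμ]
  · simp only [map_sum, map_smul, smul_eq_mul, map_mul, map_pow, Polynomial.coe_mapRingHom,
      Polynomial.map_X]
    refine Finset.sum_congr rfl fun ρ _ => ?_
    congr 1
    rw [show coeff m (GP μ ρ) = GP μ ρ m from rfl, GP, Polynomial.map_sum]
    simp
  · intro ρ T
    rw [Set.Finite.mem_toFinset]
    refine and_congr_left fun _ => ?_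
    exact ⟨fun h => ⟨h.toIsSetShYTQ, fun _ => h.diag⟩, fun h => ⟨h.1, h.2 rfl⟩⟩

end StrictPartition

/-! ### The theorem -/

theorem mainTheorem2 (ν μ : StrictPartition) (hνμ : ν ≤ μ) :
    StrictPartition.toRat (StrictPartition.GQQ μ ν) =
      ∑ p ∈ (StrictPartition.skewPairs_finite ν μ).toFinset,
        ((2 : Polynomial ℚ) ^ (μ.len - ν.len + StrictPartition.overlap ν p.1) *
            (-1 : Polynomial ℚ) ^ StrictPartition.cols p.2 μ *
            (-(Polynomial.C (1 / 2 : ℚ) * Polynomial.X)) ^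
              (StrictPartition.skewSize ν p.1 + StrictPartition.skewSize p.2 μ)) •
          StrictPartition.toRat (StrictPartition.GPP p.2 p.1) := by
  open StrictPartition in
  classical
  ext1 m
  obtain ⟨K, hK⟩ : ∃ K, ∀ k ∈ m.support, k < K :=
    ⟨m.support.sup id + 1, fun k hk => Nat.lt_succ_of_le (Finset.le_sup (f := id) hk)⟩
  -- The normalisation `-(2 * b₀) = β` makes the factor `1 + xβ` of a free box equal to `1 - 2 * b₀
  -- * x`; `h₀` is the inverse of 2 needed for the inverse matrix.
  set b₀ : Polynomial ℚ := -(Polynomial.C (1 / 2 : ℚ) * Polynomial.X) with hb₀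
  set h₀ : Polynomial ℚ := Polynomial.C (1 / 2 : ℚ) with hh₀
  have hh : 2 * h₀ = 1 := by
    rw [hh₀, show (2 : Polynomial ℚ) = Polynomial.C 2 from rfl, ← Polynomial.C_mul]
    norm_num
  have hβ : -(2 * MvPowerSeries.C b₀) =
      (MvPowerSeries.C Polynomial.X : MvPowerSeries ℕ (Polynomial ℚ)) := by
    have : (Polynomial.X : Polynomial ℚ) = -(2 * b₀) := by
      rw [hb₀, mul_neg, neg_neg, ← mul_assoc, hh, one_mul]
    rw [← map_ofNat (MvPowerSeries.C (σ := ℕ) (R := Polynomial ℚ)) 2, ← map_mul, ← map_neg,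
      ← this]
  have hC : 2 * (MvPowerSeries.C h₀ : MvPowerSeries ℕ (Polynomial ℚ)) = 1 := by
    rw [← map_one MvPowerSeries.C, ← hh, map_mul, map_ofNat]
  -- Both bounds are `μ.parts 0 + 1`, since a vertical strip can lengthen the first row by one box.
  have key := tableauSum_false_eq_sum (MvPowerSeries.C b₀) (MvPowerSeries.C h₀) hC
    MvPowerSeries.X K hνμ le_rfl le_rfl
  rw [hβ] at key
  rw [coeff_toRat_GQQ hνμ hK, key, ← Finset.sum_product', map_sum, map_sum]
  symm
  -- Pairs outside `skewPairs` contribute nothing: one of the two change of basis entries is zero.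
  refine Finset.sum_subset_zero_on_sdiff (fun p hp => ?_) (fun p hp => ?_) fun p hp => ?_
  · rw [Set.Finite.mem_toFinset] at hp
    obtain ⟨h1, -, h3, -, -, -, h7⟩ := hp
    rw [isVerticalStrip_iff] at h7
    rw [Finset.mem_product, mem_bounded, mem_bounded]
    exact ⟨((h1 0).trans (hνμ 0)).trans (Nat.le_succ _), h7 0⟩
  · rw [Finset.mem_sdiff, Finset.mem_product, mem_bounded, mem_bounded,
      Set.Finite.mem_toFinset] at hp
    obtain ⟨⟨h1, h2⟩, h3⟩ := hp
    have hν0 := hνμ 0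
    by_cases hκ : p.1 ≤ ν ∧ p.1.len = ν.len
    · have hl : ¬ (μ ≤ p.2 ∧ μ.len = p.2.len ∧ IsVerticalStrip p.2 μ) := fun hl =>
        h3 ⟨hκ.1, hνμ, hl.1, hκ.2, len_le_len hνμ, hl.2.1, hl.2.2⟩
      rw [basisChange, prod_arow_eq_zero (by omega) h2 hl, zero_mul, zero_mul, map_zero]
    · rw [basisChangeInv, prod_brow_eq_zero h1 (by omega) hκ, mul_zero, map_zero]
  · rw [Set.Finite.mem_toFinset] at hp
    obtain ⟨h1, -, h3, h4, h5, h6, h7⟩ := hp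
    have hν0 := hνμ 0
    have h70 := isVerticalStrip_iff.1 h7 0
    have hle : p.1 ≤ p.2 := fun i => ((h1 i).trans (hνμ i)).trans (h3 i)
    have e1 : basisChange (MvPowerSeries.C b₀ : MvPowerSeries ℕ (Polynomial ℚ))
        (μ.parts 0 + 1) μ p.2 =
        MvPowerSeries.C (2 ^ μ.len * ((-1) ^ cols p.2 μ * b₀ ^ skewSize p.2 μ)) := by
      rw [basisChange, prod_arow h70 h3 h6 h7]
      simp only [map_mul, map_pow, map_neg, map_one, map_ofNat]
    have e2 : basisChangeInv (MvPowerSeries.C b₀ : MvPowerSeries ℕ (Polynomial ℚ))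
        (MvPowerSeries.C h₀) (μ.parts 0 + 1) p.1 ν =
        MvPowerSeries.C (h₀ ^ ν.len * (2 ^ overlap ν p.1 * b₀ ^ skewSize ν p.1)) := by
      rw [basisChangeInv, prod_brow (by omega) h1 h4]
      simp only [map_mul, map_pow, map_ofNat]
    rw [e1, e2, map_smul, smul_eq_mul, coeff_toRat_GPP hle hK, MvPowerSeries.coeff_mul_C,
      MvPowerSeries.coeff_C_mul]
    -- The powers of 2 from the change of basis and of 1/2 from its inverse leave the exponent `ℓ(μ)
    -- - ℓ(ν)`, which is a true difference as `ν ⊆ μ`.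
    have e3 : (2 : Polynomial ℚ) ^ μ.len * h₀ ^ ν.len = 2 ^ (μ.len - ν.len) := by
      rw [← Nat.sub_add_cancel h5, pow_add, mul_assoc, ← mul_pow, hh, one_pow, mul_one,
        Nat.sub_add_cancel h5]
    rw [pow_add, pow_add, ← e3]
    ring
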